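/- Let $Q$ be a generalized quantifier of type $\langle k\rangle$, that is, a class of structures $(M,A)$ with $A\subseteq M^k$, and write $Q_M=\{A\subseteq M^k : (M,A)\in Q\}$. Assume that $Q$ is monotone: if $A\subseteq B\subseteq M^k$ and $A\in Q_M$, then $B\in Q_M$. No non-triviality is assumed: $Q_M$ may be empty or contain $\emptyset$ for some or all universes $M$. Let $Q^d=\{(M,M^k\setminus A) : A\subseteq M^k,\ (M,A)\notin Q\}$ be the dual of $Q$. The following logics are considered over an arbitrary vocabulary $\tau$ and (non-empty) $\tau$-structures $\mathbb M$ with universe $M$. * $\mathrm{FO}(Q)$ is first-order logic (with equality and unrestricted negation) extended by the quantifier $Q$, where $\mathbb M,s\models Q\bar x\,\varphi$ iff $\{\bar a\in M^k : \mathbb M,s[\bar a/\bar x]\models\varphi\}\in Q_M$. * The formulas of $\mathrm{ESO}(Q,Q^d)$ are built from atomic and negated atomic formulas by $\wedge$, $\vee$, first-order $\exists$ and $\forall$, the quantifiers $Q$ and $Q^d$ (with the semantics above), and existential quantification of relations and of functions of any arity. * The formulas of $\mathrm D(Q,Q^d)$ are built from atomic and negated atomic formulas, dependence atoms $D(t_1,\dots,t_{m+1})$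 and negated dependence atoms by $\wedge$, $\vee$, $\exists$, $\forall$, $Q$ and $Q^d$. They are interpreted in teams $X$, that is, sets of assignments with a common finite domain of variables: $X$ satisfies a first-order atomic or negated atomic formula iff every $s\in X$ does; $X$ satisfies $D(t_1,\dots,t_{m+1})$ iff any two $s,s'\in X$ which agree on the values of $t_1,\dots,t_m$ agree on the value of $t_{m+1}$; $X$ satisfies a negated dependence atom iff $X=\emptyset$; $X$ satisfies $\varphi\wedge\psi$ iff it satisfies both; $X$ satisfies $\varphi\vee\psi$ iff $X=Y\cup Z$ for some teams $Y$ satisfying $\varphi$ and $Z$ satisfying $\psi$; $X$ satisfies $\exists y\,\varphi$ iff $\{s[f(s)/y] : s\in X\}$ satisfies $\varphi$ for some $f\colon X\to M$; $X$ satisfies $\forall y\,\varphi$ iff $\{s[a/y] : s\in X,\ a\in M\}$ satisfies $\varphi$; and, for $P\in\{Q,Q^d\}$, $X$ satisfies $P\bar x\,\varphi$ iff there is $F\colon X\to P_M$ such that $\{s[\bar a/\bar x] : s\in X,\ \bar a\in F(s)\}$ satisfies $\varphi$. A sentence is true in $\mathbb M$ iff it is satisfied by the team whose only member is the empty assignment.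 Then $\mathrm{ESO}(Q,Q^d)\equiv\mathrm D(Q,Q^d)$: for every vocabulary $\tau$, every $\tau$-sentence of $\mathrm{ESO}(Q,Q^d)$ is true in exactly the same $\tau$-structures as some $\tau$-sentence of $\mathrm D(Q,Q^d)$, and conversely. Moreover $\mathrm{FO}(Q)\le\mathrm D(Q,Q^d)$: every $\tau$-sentence of $\mathrm{FO}(Q)$ is true in exactly the same $\tau$-structures as some $\tau$-sentence of $\mathrm D(Q,Q^d)$. -/

import Mathlib

universe u v w

namespace TeamLogic

/-! ### Generalized quantifiers -/

/-- A generalized quantifier of type `⟨k⟩`: a class of structures `(M, A)` with `A ⊆ M ^ k`,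
given by the families `Q M = {A | (M, A) ∈ Q}`. -/
def GenQuantifier (k : ℕ) : Type (u + 1) :=
  ∀ M : Type u, Set (Set (Fin k → M))

/-- `Q` is monotone (increasing). -/
def GenQuantifier.Mono {k : ℕ} (Q : GenQuantifier.{u} k) : Prop :=
  ∀ (M : Type u) (A B : Set (Fin k → M)), A ⊆ B → A ∈ Q M → B ∈ Q M

/-- The dual quantifier `{(M, Aᶜ) | (M, A) ∉ Q}`. -/
def GenQuantifier.dual {k : ℕ} (Q : GenQuantifier.{u} k) : GenQuantifier.{u} k :=
  fun M => {B | ∃ A : Set (Fin k → M), A ∉ Q M ∧ B = Aᶜ}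

/-! ### Atomic first-order formulas

In all logics below the formulas are well scoped: `n` is the number of variables in scope, and a
quantifier binds fresh variables, which are put after the `n` old ones. Sentences have `n = 0`. -/

/-- Atomic first-order formulas of the vocabulary `L` in the variables `x_0, …, x_{n-1}`. -/
inductive Atom (L : FirstOrder.Language.{v, w}) (n : ℕ) : Type (max v w)
  | eq (t₁ t₂ : L.Term (Fin n)) : Atom L n
  | rel {m : ℕ} (R : L.Relations m) (ts : Fin m → L.Term (Fin n)) : Atom L n

/-- Truth of an atomic formula under a single assignment. -/
def Atom.Holds {L : FirstOrder.Language.{v, w}} {n : ℕ} {M : Type u} (S : L.Structure M) :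
    Atom L n → (Fin n → M) → Prop
  | .eq t₁ t₂, s => t₁.realize s = t₂.realize s
  | .rel R ts, s => FirstOrder.Language.Structure.RelMap R (fun i => (ts i).realize s)

/-! ### First-order logic with generalized quantifiers -/

/-- Formulas of `FO(Q_i : i ∈ ι)`, all `Q_i` being of type `⟨k⟩`; negation is unrestricted. -/
inductive FOFormula (k : ℕ) (ι : Type) (L : FirstOrder.Language.{v, w}) : ℕ → Type (max v w)
  | atom {n : ℕ} (a : Atom L n) : FOFormula k ι L n
  | neg {n : ℕ} (φ : FOFormula k ι L n) : FOFormula k ι L n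
  | and {n : ℕ} (φ ψ : FOFormula k ι L n) : FOFormula k ι L n
  | or {n : ℕ} (φ ψ : FOFormula k ι L n) : FOFormula k ι L n
  | ex {n : ℕ} (φ : FOFormula k ι L (n + 1)) : FOFormula k ι L n
  | all {n : ℕ} (φ : FOFormula k ι L (n + 1)) : FOFormula k ι L n
  | quant {n : ℕ} (i : ι) (φ : FOFormula k ι L (n + k)) : FOFormula k ι L n

/-- Tarskian satisfaction for `FO(Q_i : i ∈ ι)`. -/
def FOFormula.Sat {k : ℕ} {ι : Type} (Q : ι → GenQuantifier.{u} k) {L : FirstOrder.Language.{v, w}}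
    {M : Type u} (S : L.Structure M) : {n : ℕ} → FOFormula k ι L n → (Fin n → M) → Prop
  | _, .atom a, s => a.Holds S s
  | _, .neg φ, s => ¬ φ.Sat Q S s
  | _, .and φ ψ, s => φ.Sat Q S s ∧ ψ.Sat Q S s
  | _, .or φ ψ, s => φ.Sat Q S s ∨ ψ.Sat Q S s
  | _, .ex φ, s => ∃ a : M, φ.Sat Q S (Fin.snoc s a)
  | _, .all φ, s => ∀ a : M, φ.Sat Q S (Fin.snoc s a)
  | _, .quant i φ, s => {a : Fin k → M | φ.Sat Q S (Fin.append s a)} ∈ Q i M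

/-- Truth of a sentence of `FO(Q_i : i ∈ ι)` in the structure `M`. -/
def FOFormula.TrueIn {k : ℕ} {ι : Type} (Q : ι → GenQuantifier.{u} k) {L : FirstOrder.Language.{v, w}}
    (φ : FOFormula k ι L 0) (M : Type u) [S : L.Structure M] : Prop :=
  φ.Sat Q S (Fin.elim0 : Fin 0 → M)

/-! ### Existential second-order logic with generalized quantifiers -/

/-- The family of symbol types with exactly one symbol, which has arity `m`. -/
inductive OneSym (m : ℕ) : ℕ → Type
  | sym : OneSym m m

/-- The vocabulary with a single function symbol, of arity `m`. -/
def funVar (m : ℕ) : FirstOrder.Language.{0, 0} := ⟨OneSym m, fun _ => Empty⟩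

/-- The vocabulary with a single relation symbol, of arity `m`. -/
def relVar (m : ℕ) : FirstOrder.Language.{0, 0} := ⟨fun _ => Empty, OneSym m⟩

/-- The expansion of `S` that interprets one new function symbol by `f`. -/
abbrev expandFun {L : FirstOrder.Language.{v, w}} {M : Type u} (S : L.Structure M) {m : ℕ}
    (f : (Fin m → M) → M) : (L.sum (funVar m)).Structure M :=
  letI : (funVar m).Structure M :=
    { funMap := fun g => match g with
        | .sym => f
      RelMap := fun r => nomatch r }
  L.sumStructure (funVar m) M

/-- The expansion of `S` that interprets one new relation symbol by `R`. -/
abbrev expandRel {L : FirstOrder.Language.{v, w}} {M : Type u} (S : L.Structure M) {m : ℕ}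
    (R : (Fin m → M) → Prop) : (L.sum (relVar m)).Structure M :=
  letI : (relVar m).Structure M :=
    { funMap := fun g => nomatch g
      RelMap := fun r => match r with
        | .sym => R }
  L.sumStructure (relVar m) M

/-- Formulas of `ESO(Q_i : i ∈ ι)`, all `Q_i` being of type `⟨k⟩`. A bound second-order variable
is a symbol that is added to the vocabulary. -/
inductive ESOFormula (k : ℕ) (ι : Type) :
    FirstOrder.Language.{v, w} → ℕ → Type (max (v + 1) (w + 1))
  | atom {L : FirstOrder.Language.{v, w}} {n : ℕ} (a : Atom L n) : ESOFormula k ι L n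
  | natom {L : FirstOrder.Language.{v, w}} {n : ℕ} (a : Atom L n) : ESOFormula k ι L n
  | and {L : FirstOrder.Language.{v, w}} {n : ℕ} (φ ψ : ESOFormula k ι L n) : ESOFormula k ι L n
  | or {L : FirstOrder.Language.{v, w}} {n : ℕ} (φ ψ : ESOFormula k ι L n) : ESOFormula k ι L n
  | ex {L : FirstOrder.Language.{v, w}} {n : ℕ} (φ : ESOFormula k ι L (n + 1)) : ESOFormula k ι L n
  | all {L : FirstOrder.Language.{v, w}} {n : ℕ} (φ : ESOFormula k ι L (n + 1)) : ESOFormula k ι L n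
  | quant {L : FirstOrder.Language.{v, w}} {n : ℕ} (i : ι) (φ : ESOFormula k ι L (n + k)) :
      ESOFormula k ι L n
  | exFun {L : FirstOrder.Language.{v, w}} {n : ℕ} (m : ℕ) (φ : ESOFormula k ι (L.sum (funVar m)) n) :
      ESOFormula k ι L n
  | exRel {L : FirstOrder.Language.{v, w}} {n : ℕ} (m : ℕ) (φ : ESOFormula k ι (L.sum (relVar m)) n) :
      ESOFormula k ι L n

/-- Tarskian satisfaction for `ESO(Q_i : i ∈ ι)` (full second-order semantics). -/
def ESOFormula.Sat {k : ℕ} {ι : Type} (Q : ι → GenQuantifier.{u} k) {M : Type u} :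
    {L : FirstOrder.Language.{v, w}} → {n : ℕ} → ESOFormula k ι L n → L.Structure M → (Fin n → M) → Prop
  | _, _, .atom a, S, s => a.Holds S s
  | _, _, .natom a, S, s => ¬ a.Holds S s
  | _, _, .and φ ψ, S, s => φ.Sat Q S s ∧ ψ.Sat Q S s
  | _, _, .or φ ψ, S, s => φ.Sat Q S s ∨ ψ.Sat Q S s
  | _, _, .ex φ, S, s => ∃ a : M, φ.Sat Q S (Fin.snoc s a)
  | _, _, .all φ, S, s => ∀ a : M, φ.Sat Q S (Fin.snoc s a)
  | _, _, .quant i φ, S, s => {a : Fin k → M | φ.Sat Q S (Fin.append s a)} ∈ Q i M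
  | _, _, .exFun m φ, S, s => ∃ f : (Fin m → M) → M, φ.Sat Q (expandFun S f) s
  | _, _, .exRel m φ, S, s => ∃ R : (Fin m → M) → Prop, φ.Sat Q (expandRel S R) s

/-- Truth of a sentence of `ESO(Q_i : i ∈ ι)` in the structure `M`. -/
def ESOFormula.TrueIn {k : ℕ} {ι : Type} (Q : ι → GenQuantifier.{u} k) {L : FirstOrder.Language.{v, w}}
    (φ : ESOFormula k ι L 0) (M : Type u) [S : L.Structure M] : Prop :=
  φ.Sat Q S (Fin.elim0 : Fin 0 → M)

/-! ### Dependence logic with generalized quantifiers -/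

/-- Formulas of `D(Q_i : i ∈ ι)`, all `Q_i` being of type `⟨k⟩`, in negation normal form.
`dep ts t` is the dependence atom `D(ts, t)`, and `ndep ts t` is its negation. -/
inductive DFormula (k : ℕ) (ι : Type) (L : FirstOrder.Language.{v, w}) : ℕ → Type (max v w)
  | atom {n : ℕ} (a : Atom L n) : DFormula k ι L n
  | natom {n : ℕ} (a : Atom L n) : DFormula k ι L n
  | dep {n m : ℕ} (ts : Fin m → L.Term (Fin n)) (t : L.Term (Fin n)) : DFormula k ι L n
  | ndep {n m : ℕ} (ts : Fin m → L.Term (Fin n)) (t : L.Term (Fin n)) : DFormula k ι L n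
  | and {n : ℕ} (φ ψ : DFormula k ι L n) : DFormula k ι L n
  | or {n : ℕ} (φ ψ : DFormula k ι L n) : DFormula k ι L n
  | ex {n : ℕ} (φ : DFormula k ι L (n + 1)) : DFormula k ι L n
  | all {n : ℕ} (φ : DFormula k ι L (n + 1)) : DFormula k ι L n
  | quant {n : ℕ} (i : ι) (φ : DFormula k ι L (n + k)) : DFormula k ι L n

/-- The team `X[f/y]`, where `y` is a fresh variable. -/
def teamEx {n : ℕ} {M : Type u} (X : Set (Fin n → M)) (f : X → M) : Set (Fin (n + 1) → M) :=
  {s' | ∃ s : X, s' = Fin.snoc s.1 (f s)}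

/-- The team `X[M/y]`, where `y` is a fresh variable. -/
def teamAll {n : ℕ} {M : Type u} (X : Set (Fin n → M)) : Set (Fin (n + 1) → M) :=
  {s' | ∃ s ∈ X, ∃ a : M, s' = Fin.snoc s a}

/-- The team `X[F/y_1 … y_k]`, where the `y_j` are fresh variables. -/
def teamQuant {n k : ℕ} {M : Type u} (X : Set (Fin n → M)) (F : X → Set (Fin k → M)) :
    Set (Fin (n + k) → M) :=
  {s' | ∃ s : X, ∃ a ∈ F s, s' = Fin.append s.1 a}

/-- Satisfaction of a formula of `D(Q_i : i ∈ ι)` by a team. -/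
def DFormula.Sat {k : ℕ} {ι : Type} (Q : ι → GenQuantifier.{u} k) {L : FirstOrder.Language.{v, w}}
    {M : Type u} (S : L.Structure M) : {n : ℕ} → DFormula k ι L n → Set (Fin n → M) → Prop
  | _, .atom a, X => ∀ s ∈ X, a.Holds S s
  | _, .natom a, X => ∀ s ∈ X, ¬ a.Holds S s
  | _, .dep ts t, X => ∀ s ∈ X, ∀ s' ∈ X,
      (∀ i, (ts i).realize s = (ts i).realize s') → t.realize s = t.realize s'
  | _, .ndep _ _, X => X = ∅
  | _, .and φ ψ, X => φ.Sat Q S X ∧ ψ.Sat Q S X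
  | _, .or φ ψ, X => ∃ Y Z, X = Y ∪ Z ∧ φ.Sat Q S Y ∧ ψ.Sat Q S Z
  | _, .ex φ, X => ∃ f : X → M, φ.Sat Q S (teamEx X f)
  | _, .all φ, X => φ.Sat Q S (teamAll X)
  | _, .quant i φ, X => ∃ F : X → Set (Fin k → M),
      (∀ s, F s ∈ Q i M) ∧ φ.Sat Q S (teamQuant X F)

/-- Truth of a sentence of `D(Q_i : i ∈ ι)` in the structure `M`: the team whose only member is
the empty assignment satisfies it. -/
def DFormula.TrueIn {k : ℕ} {ι : Type} (Q : ι → GenQuantifier.{u} k) {L : FirstOrder.Language.{v, w}}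
    (φ : DFormula k ι L 0) (M : Type u) [S : L.Structure M] : Prop :=
  φ.Sat Q S {(Fin.elim0 : Fin 0 → M)}

end TeamLogic

/-!
A team is a relation, so team semantics can be spelled out in existential second-order logic: the
teams chosen along the way are quantified relations, and since satisfaction is inherited by
subteams it does not matter that they are only required to be large enough.

Conversely, the functions quantified in existential second-order logic are simulated by a team that
lists their graphs, with universally quantified variables for the arguments and existentially
quantified variables for the values; dependence atoms make the values functions of the arguments.
Since dependence atoms speak about the whole team, the invariant is that the formula is satisfied by
such a team iff every assignment, with its own functions, satisfies the original. A step for a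
monotone quantifier chooses a set of tuples for each row, possibly a different one for different
arguments of the same function; hence all graphs are guessed anew after it and compared with the old
values, so that any one row of arguments yields a good set. Disjunctions and relations are encoded
by equalizers of two functions, which fails for the empty set in a structure with a single element
and needs an extra disjunct there.

A formula of first-order logic with `Q` has a negation normal form with `Q` and its dual, which is
an existential second-order formula without second-order quantifiers.
-/

namespace TeamLogic

/-! ### Tuples and atomic formulas -/

section Tuples

variable {M : Type u} {m n : ℕ}

theorem append_comp_castAdd (s : Fin m → M) (a : Fin n → M) :
    Fin.append s a ∘ Fin.castAdd n = s :=
  funext (Fin.append_left s a)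

theorem append_comp_natAdd (s : Fin m → M) (a : Fin n → M) :
    Fin.append s a ∘ Fin.natAdd m = a :=
  funext (Fin.append_right s a)

theorem comp_append {V : Type*} (x : V → M) (f : Fin m → V) (g : Fin n → V) :
    x ∘ Fin.append f g = Fin.append (x ∘ f) (x ∘ g) := by
  ext i
  refine Fin.addCases (fun i => ?_) (fun i => ?_) i <;> simp

theorem append_inj {s s' : Fin m → M} {a a' : Fin n → M} :
    Fin.append s a = Fin.append s' a' ↔ s = s' ∧ a = a' :=
  ((Fin.appendEquiv m n).injective.eq_iff (a := (s, a)) (b := (s', a'))).trans Prod.mk_inj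

theorem append_append_one {r : ℕ} (s : Fin n → M) (a : Fin r → M) (b : Fin 1 → M) :
    Fin.append s (Fin.append a b) = Fin.append (Fin.append s a) b := by
  rw [Fin.append_right_eq_snoc, Fin.append_right_eq_snoc, Fin.append_snoc]

theorem elim_comp_finSumFinEquiv_symm (s : Fin m → M) (a : Fin n → M) :
    Sum.elim s a ∘ finSumFinEquiv.symm = Fin.append s a := by
  rw [Equiv.comp_symm_eq]
  funext i
  rcases i with i | i <;> simp

theorem append_fin_zero (s : Fin n → M) (a : Fin 0 → M) : Fin.append s a = s :=
  append_comp_castAdd s a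

end Tuples

section Atoms

variable {L L' : FirstOrder.Language.{v, w}} {M : Type u} {n n' : ℕ}

/-- The atomic formula obtained from another one by renaming its variables. -/
def Atom.relabel (σ : Fin n → Fin n') : Atom L n → Atom L n'
  | .eq t₁ t₂ => .eq (t₁.relabel σ) (t₂.relabel σ)
  | .rel R ts => .rel R (fun i => (ts i).relabel σ)

theorem Atom.holds_relabel (σ : Fin n → Fin n') (S : L.Structure M) (a : Atom L n)
    (s : Fin n' → M) : (a.relabel σ).Holds S s ↔ a.Holds S (s ∘ σ) := by
  cases a <;> simp only [Atom.relabel, Atom.Holds, FirstOrder.Language.Term.realize_relabel]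

/-- The translation of an atomic formula along a homomorphism of vocabularies. -/
def Atom.onLang (h : L →ᴸ L') : Atom L n → Atom L' n
  | .eq t₁ t₂ => .eq (h.onTerm t₁) (h.onTerm t₂)
  | .rel R ts => .rel (h.onRelation R) (fun i => h.onTerm (ts i))

theorem realize_onTerm_reduct {α : Type*} (h : L →ᴸ L') (S : L'.Structure M) (t : L.Term α)
    (s : α → M) :
    (h.onTerm t).realize s = @FirstOrder.Language.Term.realize L M (h.reduct M) α s t := by
  let _ := h.reduct M
  exact FirstOrder.Language.LHom.realize_onTerm h t s

theorem Atom.holds_onLang (h : L →ᴸ L') (S : L'.Structure M) (a : Atom L n) (s : Fin n → M) :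
    (a.onLang h).Holds S s ↔ a.Holds (h.reduct M) s := by
  cases a with
  | eq t₁ t₂ => simp only [Atom.onLang, Atom.Holds, realize_onTerm_reduct]
  | rel R ts =>
    simp only [Atom.onLang, Atom.Holds, realize_onTerm_reduct]
    rfl

/-- The atomic formula `R (x_{σ 0}, …, x_{σ (m - 1)})`. -/
def Atom.relOf {m : ℕ} (R : L.Relations m) (σ : Fin m → Fin n) : Atom L n :=
  .rel R (fun i => .var (σ i))

theorem Atom.holds_relOf {m : ℕ} (R : L.Relations m) (σ : Fin m → Fin n) (S : L.Structure M)
    (s : Fin n → M) : (Atom.relOf R σ).Holds S s ↔ S.RelMap R (s ∘ σ) := Iff.rfl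

end Atoms

/-! ### Quantifiers and extensions of teams -/

/-- The quantifier "for some `r`-tuple". -/
def existsQuantifier (r : ℕ) : GenQuantifier.{u} r := fun _ => {A | A.Nonempty}

/-- The quantifier "for all `r`-tuples". -/
def forallQuantifier (r : ℕ) : GenQuantifier.{u} r := fun _ => {Set.univ}

/-- The quantifier string `U x_1 … x_r T x_{r+1}` as a single quantifier of type `⟨r + 1⟩`. -/
def GenQuantifier.comp {r : ℕ} (U : GenQuantifier.{u} r) (T : GenQuantifier.{u} 1) :
    GenQuantifier.{u} (r + 1) :=
  fun M => {A | {a | {b | Fin.append a b ∈ A} ∈ T M} ∈ U M}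

/-- The team `X'` extends every assignment of `X` by a set of tuples in `U`. Since satisfaction is
closed under subteams, every quantifier step of dependence logic amounts to such an extension. -/
def TeamExt {M : Type u} {n r : ℕ} (U : GenQuantifier.{u} r) (X : Set (Fin n → M))
    (X' : Set (Fin (n + r) → M)) : Prop :=
  ∀ s ∈ X, {a | Fin.append s a ∈ X'} ∈ U M

section Quantifiers

variable {M : Type u} {n r : ℕ}

theorem existsQuantifier_mono : (existsQuantifier.{u} r).Mono :=
  fun _ _ _ h hA => Set.Nonempty.mono h hA

theorem forallQuantifier_mono : (forallQuantifier.{u} r).Mono :=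
  fun _ _ _ h hA => Set.univ_subset_iff.1 (hA ▸ h)

theorem mem_forallQuantifier {A : Set (Fin r → M)} : A ∈ forallQuantifier r M ↔ ∀ a, a ∈ A :=
  Set.eq_univ_iff_forall

theorem GenQuantifier.Mono.comp {U : GenQuantifier.{u} r} {T : GenQuantifier.{u} 1} (hU : U.Mono)
    (hT : T.Mono) : (U.comp T).Mono :=
  fun M _ _ h => hU M _ _ fun _ => hT M _ _ fun _ hb => h hb

theorem exists_append_one {p : (Fin (r + 1) → M) → Prop} :
    (∃ a, p a) ↔ ∃ (a : Fin r → M) (b : Fin 1 → M), p (Fin.append a b) :=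
  (Fin.appendEquiv r 1).symm.exists_congr_left.trans Prod.exists

theorem forall_append_one {p : (Fin (r + 1) → M) → Prop} :
    (∀ a, p a) ↔ ∀ (a : Fin r → M) (b : Fin 1 → M), p (Fin.append a b) :=
  (Fin.appendEquiv r 1).symm.forall_congr_left.trans Prod.forall

theorem existsQuantifier_comp :
    (existsQuantifier.{u} r).comp (existsQuantifier 1) = existsQuantifier (r + 1) :=
  funext fun _ => Set.ext fun _ => exists_append_one.symm

theorem forallQuantifier_comp :
    (forallQuantifier.{u} r).comp (forallQuantifier 1) = forallQuantifier (r + 1) := by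
  refine funext fun _ => Set.ext fun A => ?_
  simp only [GenQuantifier.comp, mem_forallQuantifier, Set.mem_ofPred_eq]
  exact forall_append_one.symm

theorem append_mem_existsQuantifier_zero {p : (Fin n → M) → Prop} {s : Fin n → M} :
    {a : Fin 0 → M | p (Fin.append s a)} ∈ existsQuantifier 0 M ↔ p s := by
  simp only [append_fin_zero]
  exact exists_const (Fin 0 → M)

theorem append_mem_forallQuantifier_zero {p : (Fin n → M) → Prop} {s : Fin n → M} :
    {a : Fin 0 → M | p (Fin.append s a)} ∈ forallQuantifier 0 M ↔ p s := by
  simp only [append_fin_zero, mem_forallQuantifier]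
  exact forall_const (Fin 0 → M)

theorem append_mem_existsQuantifier_one {p : (Fin (n + 1) → M) → Prop} {s : Fin n → M} :
    {a : Fin 1 → M | p (Fin.append s a)} ∈ existsQuantifier 1 M ↔ ∃ a, p (Fin.snoc s a) := by
  simp only [Fin.append_right_eq_snoc]
  exact (Equiv.funUnique (Fin 1) M).exists_congr_left

theorem append_mem_forallQuantifier_one {p : (Fin (n + 1) → M) → Prop} {s : Fin n → M} :
    {a : Fin 1 → M | p (Fin.append s a)} ∈ forallQuantifier 1 M ↔ ∀ a, p (Fin.snoc s a) := by
  simp only [Fin.append_right_eq_snoc, mem_forallQuantifier]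
  exact (Equiv.funUnique (Fin 1) M).forall_congr_left

theorem append_mem_comp {U : GenQuantifier.{u} r} {T : GenQuantifier.{u} 1}
    {p : (Fin (n + r + 1) → M) → Prop} {s : Fin n → M} :
    {a : Fin (r + 1) → M | p (Fin.append s a :)} ∈ U.comp T M ↔
      {a | {b | p (Fin.append (Fin.append s a) b)} ∈ T M} ∈ U M := by
  simp only [GenQuantifier.comp, Set.mem_ofPred_eq, append_append_one]

theorem teamExt_comp {U : GenQuantifier.{u} r} {T : GenQuantifier.{u} 1} (hU : U.Mono)
    {X : Set (Fin n → M)} {X'' : Set (Fin (n + r + 1) → M)} :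
    TeamExt (U.comp T) X X'' ↔ ∃ X' : Set (Fin (n + r) → M), TeamExt U X X' ∧ TeamExt T X' X'' := by
  constructor
  · intro h
    exact ⟨{y | {b | Fin.append y b ∈ X''} ∈ T M}, fun s hs => append_mem_comp.1 (h s hs),
      fun _ hy => hy⟩
  · rintro ⟨X', hX', hX''⟩ s hs
    exact append_mem_comp.2 (hU M _ _ (fun a ha => hX'' _ ha) (hX' s hs))

end Quantifiers

section DFormula

variable {k : ℕ} {ι : Type} {Q : ι → GenQuantifier.{u} k} {L : FirstOrder.Language.{v, w}}
  {M : Type u} {S : L.Structure M} {n : ℕ}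

theorem DFormula.Sat.mono {φ : DFormula k ι L n} {X Y : Set (Fin n → M)} (h : X ⊆ Y)
    (hY : φ.Sat Q S Y) : φ.Sat Q S X := by
  induction φ with
  | atom a => exact fun s hs => hY s (h hs)
  | natom a => exact fun s hs => hY s (h hs)
  | dep ts t => exact fun s hs s' hs' => hY s (h hs) s' (h hs')
  | ndep ts t => exact Set.subset_eq_empty h hY
  | and φ ψ ihφ ihψ => exact ⟨ihφ h hY.1, ihψ h hY.2⟩
  | or φ ψ ihφ ihψ =>
    obtain ⟨Y, Z, rfl, hφ, hψ⟩ := hY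
    refine ⟨X ∩ Y, X ∩ Z, ?_, ihφ Set.inter_subset_right hφ, ihψ Set.inter_subset_right hψ⟩
    rw [← Set.inter_union_distrib_left, Set.inter_eq_left.2 h]
  | ex φ ih =>
    obtain ⟨f, hf⟩ := hY
    refine ⟨fun s => f ⟨s.1, h s.2⟩, ih ?_ hf⟩
    rintro _ ⟨s, rfl⟩
    exact ⟨⟨s.1, h s.2⟩, rfl⟩
  | all φ ih =>
    refine ih ?_ hY
    rintro _ ⟨s, hs, a, rfl⟩
    exact ⟨s, h hs, a, rfl⟩
  | quant i φ ih =>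
    obtain ⟨F, hF, hφ⟩ := hY
    refine ⟨fun s => F ⟨s.1, h s.2⟩, fun s => hF _, ih ?_ hφ⟩
    rintro _ ⟨s, a, ha, rfl⟩
    exact ⟨⟨s.1, h s.2⟩, a, ha, rfl⟩

theorem DFormula.sat_or_iff {φ ψ : DFormula k ι L n} {X : Set (Fin n → M)} :
    (DFormula.or φ ψ).Sat Q S X ↔ ∃ Y Z, X ⊆ Y ∪ Z ∧ φ.Sat Q S Y ∧ ψ.Sat Q S Z := by
  constructor
  · rintro ⟨Y, Z, h, hφ, hψ⟩
    exact ⟨Y, Z, h.le, hφ, hψ⟩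
  · rintro ⟨Y, Z, h, hφ, hψ⟩
    refine ⟨X ∩ Y, X ∩ Z, ?_, hφ.mono Set.inter_subset_right, hψ.mono Set.inter_subset_right⟩
    rw [← Set.inter_union_distrib_left, Set.inter_eq_left.2 h]

theorem DFormula.sat_ex_iff {φ : DFormula k ι L (n + 1)} {X : Set (Fin n → M)} :
    (DFormula.ex φ).Sat Q S X ↔ ∃ X', TeamExt (existsQuantifier 1) X X' ∧ φ.Sat Q S X' := by
  constructor
  · rintro ⟨f, hf⟩
    exact ⟨teamEx X f, fun s hs => append_mem_existsQuantifier_one.2 ⟨f ⟨s, hs⟩, ⟨s, hs⟩, rfl⟩, hf⟩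
  · rintro ⟨X', hX', h⟩
    choose f hf using fun s hs => append_mem_existsQuantifier_one.1 (hX' s hs)
    refine ⟨fun s => f s.1 s.2, h.mono ?_⟩
    rintro _ ⟨s, rfl⟩
    exact hf _ s.2

theorem DFormula.sat_all_iff {φ : DFormula k ι L (n + 1)} {X : Set (Fin n → M)} :
    (DFormula.all φ).Sat Q S X ↔ ∃ X', TeamExt (forallQuantifier 1) X X' ∧ φ.Sat Q S X' := by
  constructor
  · intro h
    exact ⟨teamAll X, fun s hs => append_mem_forallQuantifier_one.2 fun a => ⟨s, hs, a, rfl⟩, h⟩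
  · rintro ⟨X', hX', h⟩
    refine h.mono ?_
    rintro _ ⟨s, hs, a, rfl⟩
    exact append_mem_forallQuantifier_one.1 (hX' s hs) a

theorem DFormula.sat_quant_iff {i : ι} {φ : DFormula k ι L (n + k)} {X : Set (Fin n → M)} :
    (DFormula.quant i φ).Sat Q S X ↔ ∃ X', TeamExt (Q i) X X' ∧ φ.Sat Q S X' := by
  constructor
  · rintro ⟨F, hF, h⟩
    refine ⟨_, fun s hs => ?_, h⟩
    suffices {a | Fin.append s a ∈ teamQuant X F} = F ⟨s, hs⟩ from this ▸ hF _
    ext a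
    constructor
    · rintro ⟨⟨s', hs'⟩, b, hb, e⟩
      obtain ⟨rfl, rfl⟩ := append_inj.1 e
      exact hb
    · exact fun ha => ⟨⟨s, hs⟩, a, ha, rfl⟩
  · rintro ⟨X', hX', h⟩
    refine ⟨fun s => {a | Fin.append s.1 a ∈ X'}, fun s => hX' _ s.2, h.mono ?_⟩
    rintro _ ⟨s, a, ha, rfl⟩
    exact ha

end DFormula

/-! ### Dependence logic in existential second-order logic -/

/-- A property of structures with an assignment of the variables `x_0, …, x_{n-1}`. -/
abbrev AssignmentProperty (L : FirstOrder.Language.{v, w}) (n : ℕ) : Type (max (u + 1) v w) :=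
  ∀ M : Type u, L.Structure M → (Fin n → M) → Prop

/-- A property of structures with a team of assignments of the variables in `V`. -/
abbrev TeamProperty (L : FirstOrder.Language.{v, w}) (V : Type) : Type (max (u + 1) v w) :=
  ∀ M : Type u, L.Structure M → Set (V → M) → Prop

/-- The property `A` is expressed by a formula of `ESO(Q_i : i ∈ ι)`. -/
def ESODefinable {k : ℕ} {ι : Type} (Q : ι → GenQuantifier.{u} k) (L : FirstOrder.Language.{v, w})
    (n : ℕ) (A : AssignmentProperty.{u} L n) : Prop :=
  ∃ φ : ESOFormula k ι L n, ∀ (M : Type u) (S : L.Structure M) (s : Fin n → M),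
    φ.Sat Q S s ↔ A M S s

/-- Definability in `ESO(Q_i : i ∈ ι)` is closed under the quantifier `U`. -/
def ESOExpressible {k : ℕ} {ι : Type} (Q : ι → GenQuantifier.{u} k)
    (L : FirstOrder.Language.{v, w}) {r : ℕ} (U : GenQuantifier.{u} r) : Prop :=
  ∀ ⦃n : ℕ⦄ ⦃A : AssignmentProperty.{u} L (n + r)⦄, ESODefinable Q L (n + r) A →
    ESODefinable Q L n fun M S s => {a : Fin r → M | A M S (Fin.append s a)} ∈ U M

section ESODefinable

variable {k : ℕ} {ι : Type} {Q : ι → GenQuantifier.{u} k} {L : FirstOrder.Language.{v, w}}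
  {n r : ℕ} {A B : AssignmentProperty.{u} L n}

theorem ESODefinable.atom (a : Atom L n) : ESODefinable Q L n fun _ S s => a.Holds S s :=
  ⟨.atom a, fun _ _ _ => Iff.rfl⟩

theorem ESODefinable.natom (a : Atom L n) : ESODefinable Q L n fun _ S s => ¬ a.Holds S s :=
  ⟨.natom a, fun _ _ _ => Iff.rfl⟩

theorem ESODefinable.congr (hA : ESODefinable Q L n A) (h : ∀ M S s, A M S s ↔ B M S s) :
    ESODefinable Q L n B :=
  let ⟨φ, hφ⟩ := hA
  ⟨φ, fun M S s => (hφ M S s).trans (h M S s)⟩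

theorem ESODefinable.and (hA : ESODefinable Q L n A) (hB : ESODefinable Q L n B) :
    ESODefinable Q L n fun M S s => A M S s ∧ B M S s :=
  let ⟨φ, hφ⟩ := hA
  let ⟨ψ, hψ⟩ := hB
  ⟨.and φ ψ, fun M S s => and_congr (hφ M S s) (hψ M S s)⟩

theorem ESODefinable.or (hA : ESODefinable Q L n A) (hB : ESODefinable Q L n B) :
    ESODefinable Q L n fun M S s => A M S s ∨ B M S s :=
  let ⟨φ, hφ⟩ := hA
  let ⟨ψ, hψ⟩ := hB
  ⟨.or φ ψ, fun M S s => or_congr (hφ M S s) (hψ M S s)⟩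

theorem ESODefinable.ex {A : AssignmentProperty.{u} L (n + 1)} (hA : ESODefinable Q L (n + 1) A) :
    ESODefinable Q L n fun M S s => ∃ a, A M S (Fin.snoc s a) :=
  let ⟨φ, hφ⟩ := hA
  ⟨.ex φ, fun M S _ => exists_congr fun _ => hφ M S _⟩

theorem ESODefinable.all {A : AssignmentProperty.{u} L (n + 1)} (hA : ESODefinable Q L (n + 1) A) :
    ESODefinable Q L n fun M S s => ∀ a, A M S (Fin.snoc s a) :=
  let ⟨φ, hφ⟩ := hA
  ⟨.all φ, fun M S _ => forall_congr' fun _ => hφ M S _⟩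

theorem ESODefinable.exRel {m : ℕ} {A : AssignmentProperty.{u} (L.sum (relVar m)) n}
    (hA : ESODefinable Q (L.sum (relVar m)) n A) :
    ESODefinable Q L n fun M S s => ∃ X : Set (Fin m → M), A M (expandRel S (· ∈ X)) s :=
  let ⟨φ, hφ⟩ := hA
  ⟨.exRel m φ, fun M _ _ => exists_congr fun _ => hφ M _ _⟩

theorem ESODefinable.forall_fin_imp (hB : ESODefinable Q L n B) :
    ∀ {m : ℕ} {A : Fin m → AssignmentProperty.{u} L n},
      (∀ j, ESODefinable Q L n fun M S s => ¬ A j M S s) →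
        ESODefinable Q L n fun M S s => (∀ j, A j M S s) → B M S s
  | 0, _, _ => hB.congr fun _ _ _ => (imp_iff_right fun j : Fin 0 => j.elim0).symm
  | _ + 1, _, hA => ((hA 0).or (hB.forall_fin_imp fun j => hA j.succ)).congr fun _ _ _ => by
      rw [Fin.forall_fin_succ, and_imp, ← imp_iff_not_or]

theorem esoExpressible_apply (i : ι) : ESOExpressible Q L (Q i) := fun n A ⟨φ, hφ⟩ =>
  ⟨.quant i φ, fun M S s => by simp only [ESOFormula.Sat, hφ]⟩

theorem esoExpressible_existsQuantifier_one : ESOExpressible Q L (existsQuantifier.{u} 1) :=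
  fun _ _ hA => hA.ex.congr fun _ _ _ => append_mem_existsQuantifier_one.symm

theorem esoExpressible_forallQuantifier_one : ESOExpressible Q L (forallQuantifier.{u} 1) :=
  fun _ _ hA => hA.all.congr fun _ _ _ => append_mem_forallQuantifier_one.symm

theorem ESOExpressible.comp {U : GenQuantifier.{u} r} {T : GenQuantifier.{u} 1}
    (hU : ESOExpressible Q L U) (hT : ESOExpressible Q L T) : ESOExpressible Q L (U.comp T) :=
  fun _ _ hA => (hU (hT hA)).congr fun _ _ _ => append_mem_comp.symm

theorem esoExpressible_forallQuantifier : ∀ r, ESOExpressible Q L (forallQuantifier.{u} r)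
  | 0 => fun _ _ hA => hA.congr fun _ _ _ => append_mem_forallQuantifier_zero.symm
  | r + 1 => forallQuantifier_comp ▸
      (esoExpressible_forallQuantifier r).comp esoExpressible_forallQuantifier_one

end ESODefinable

/-- The interpretation of a relation symbol, viewed as a team. -/
def relTeam {L : FirstOrder.Language.{v, w}} {n : ℕ} (R : L.Relations n) {M : Type u}
    (S : L.Structure M) : Set (Fin n → M) :=
  {s | S.RelMap R s}

/-- The property `P` of teams is expressed in `ESO(Q_i : i ∈ ι)` by sentences about any relation
symbol `R`, possibly of a larger vocabulary, that is interpreted by the team. -/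
def TeamESODefinable {k : ℕ} {ι : Type} (Q : ι → GenQuantifier.{u} k)
    (L : FirstOrder.Language.{v, w}) (n : ℕ) (P : TeamProperty.{u} L (Fin n)) : Prop :=
  ∀ ⦃L' : FirstOrder.Language.{v, w}⦄ (h : L →ᴸ L') (R : L'.Relations n),
    ESODefinable Q L' 0 fun M S _ => P M (h.reduct M) (relTeam R S)

section TeamESODefinable

variable {k : ℕ} {ι : Type} {Q : ι → GenQuantifier.{u} k} {L L' : FirstOrder.Language.{v, w}}
  {m n : ℕ}

theorem ESODefinable.mem_relTeam (R : L.Relations m) (σ : Fin m → Fin n) :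
    ESODefinable Q L n fun _ S s => s ∘ σ ∈ relTeam R S :=
  .atom (Atom.relOf R σ)

theorem ESODefinable.forall_mem_relTeam (R : L.Relations n) {A : AssignmentProperty.{u} L (m + n)}
    (hA : ESODefinable Q L (m + n) A) :
    ESODefinable Q L m fun M S s => ∀ x ∈ relTeam R S, A M S (Fin.append s x) := by
  refine (esoExpressible_forallQuantifier n
    ((ESODefinable.natom (Atom.relOf R (Fin.natAdd m))).or hA)).congr fun M S s => ?_
  simp only [mem_forallQuantifier, Set.mem_ofPred_eq, Atom.holds_relOf, append_comp_natAdd,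
    ← imp_iff_not_or]
  rfl

theorem TeamESODefinable.atom (a : Atom L n) :
    TeamESODefinable Q L n fun _ S X => ∀ s ∈ X, a.Holds S s := fun _ h R =>
  ((ESODefinable.atom ((a.onLang h).relabel (Fin.natAdd 0))).forall_mem_relTeam R).congr
    fun _ _ _ => by simp only [Atom.holds_relabel, append_comp_natAdd, Atom.holds_onLang]

theorem TeamESODefinable.natom (a : Atom L n) :
    TeamESODefinable Q L n fun _ S X => ∀ s ∈ X, ¬ a.Holds S s := fun _ h R =>
  ((ESODefinable.natom ((a.onLang h).relabel (Fin.natAdd 0))).forall_mem_relTeam R).congr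
    fun _ _ _ => by simp only [Atom.holds_relabel, append_comp_natAdd, Atom.holds_onLang]

/-- The atomic formula stating that `t` has the same value at the assignments of its variables
given by `σ` and by `τ`. -/
def Atom.sameValue (t : L.Term (Fin m)) (σ τ : Fin m → Fin n) : Atom L n :=
  .eq (t.relabel σ) (t.relabel τ)

theorem Atom.holds_sameValue {M : Type u} (S : L.Structure M) (t : L.Term (Fin m))
    (σ τ : Fin m → Fin n) (s : Fin n → M) :
    (Atom.sameValue t σ τ).Holds S s ↔ t.realize (s ∘ σ) = t.realize (s ∘ τ) := by
  simp only [Atom.sameValue, Atom.Holds, FirstOrder.Language.Term.realize_relabel]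

theorem TeamESODefinable.dep (ts : Fin m → L.Term (Fin n)) (t : L.Term (Fin n)) :
    TeamESODefinable Q L n fun _ _ X => ∀ s ∈ X, ∀ s' ∈ X,
      (∀ i, (ts i).realize s = (ts i).realize s') → t.realize s = t.realize s' := by
  intro L' h R
  let same (t : L.Term (Fin n)) : Atom L' (0 + n + n) :=
    (Atom.sameValue t (Fin.castAdd n ∘ Fin.natAdd 0) (Fin.natAdd (0 + n))).onLang h
  have holds_same (t : L.Term (Fin n)) {M : Type u} (S : L'.Structure M) (z : Fin 0 → M)
      (s s' : Fin n → M) : (same t).Holds S (Fin.append (Fin.append z s) s') ↔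
        @FirstOrder.Language.Term.realize L M (h.reduct M) _ s t =
          @FirstOrder.Language.Term.realize L M (h.reduct M) _ s' t := by
    rw [Atom.holds_onLang, Atom.holds_sameValue, ← Function.comp_assoc, append_comp_castAdd,
      append_comp_natAdd, append_comp_natAdd]
  refine ((((ESODefinable.atom (same t)).forall_fin_imp fun i =>
    .natom (same (ts i))).forall_mem_relTeam R).forall_mem_relTeam R).congr fun _ _ _ => ?_
  simp only [holds_same]

theorem TeamESODefinable.empty : TeamESODefinable Q L n fun _ _ X => X = ∅ := fun _ _ R =>
  (esoExpressible_forallQuantifier n (ESODefinable.natom (Atom.relOf R (Fin.natAdd 0)))).congr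
    fun _ S z => by
      simp only [mem_forallQuantifier, Set.mem_ofPred_eq, Atom.holds_relOf, append_comp_natAdd]
      exact Set.eq_empty_iff_forall_notMem.symm

variable {P P' : TeamProperty.{u} L (Fin n)}

theorem TeamESODefinable.and (hP : TeamESODefinable Q L n P) (hP' : TeamESODefinable Q L n P') :
    TeamESODefinable Q L n fun M S X => P M S X ∧ P' M S X :=
  fun _ h R => (hP h R).and (hP' h R)

theorem TeamESODefinable.or (hP : TeamESODefinable Q L n P) (hP' : TeamESODefinable Q L n P') :
    TeamESODefinable Q L n fun M S X => ∃ Y Z, X ⊆ Y ∪ Z ∧ P M S Y ∧ P' M S Z := by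
  intro L' h R
  let L'' := (L'.sum (relVar n)).sum (relVar n)
  let Y : L''.Relations n := .inl (.inr .sym)
  let Z : L''.Relations n := .inr .sym
  let h' : L →ᴸ L'' := FirstOrder.Language.LHom.sumInl.comp (FirstOrder.Language.LHom.sumInl.comp h)
  let R'' : L''.Relations n := .inl (.inl R)
  have hcover : ESODefinable Q L'' 0 fun M S _ => relTeam R'' S ⊆ relTeam Y S ∪ relTeam Z S := by
    refine (((ESODefinable.mem_relTeam Y (Fin.natAdd 0)).or
      (.mem_relTeam Z (Fin.natAdd 0))).forall_mem_relTeam R'').congr fun M S z => ?_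
    simp only [append_comp_natAdd]
    rfl
  exact (hcover.and ((hP h' Y).and (hP' h' Z))).exRel.exRel

theorem TeamESODefinable.quantify {r : ℕ} {U : GenQuantifier.{u} r}
    {P : TeamProperty.{u} L (Fin (n + r))}
    (hU : ∀ L' : FirstOrder.Language.{v, w}, ESOExpressible Q L' U)
    (hP : TeamESODefinable Q L (n + r) P) :
    TeamESODefinable Q L n fun M S X => ∃ X', TeamExt U X X' ∧ P M S X' := by
  intro L' h R
  let X' : (L'.sum (relVar (n + r))).Relations (n + r) := .inr .sym
  have hext : ESODefinable Q (L'.sum (relVar (n + r))) 0 fun M S _ =>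
      TeamExt U (relTeam (Sum.inl R) S) (relTeam X' S) := by
    refine ((hU _ (ESODefinable.mem_relTeam X' (Fin.append (Fin.castAdd r ∘ Fin.natAdd 0)
      (Fin.natAdd (0 + n))))).forall_mem_relTeam (Sum.inl R)).congr fun M S z => ?_
    simp only [comp_append, ← Function.comp_assoc, append_comp_castAdd, append_comp_natAdd]
    rfl
  exact (hext.and (hP (FirstOrder.Language.LHom.sumInl.comp h) X')).exRel

end TeamESODefinable

section DFormula

variable {k : ℕ} {ι : Type} (Q : ι → GenQuantifier.{u} k) {L : FirstOrder.Language.{v, w}} {n : ℕ}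

theorem DFormula.teamESODefinable (ψ : DFormula k ι L n) :
    TeamESODefinable Q L n fun _ S X => ψ.Sat Q S X := by
  induction ψ with
  | atom a => exact .atom a
  | natom a => exact .natom a
  | dep ts t => exact .dep ts t
  | ndep => exact .empty
  | and φ ψ ihφ ihψ => exact ihφ.and ihψ
  | or φ ψ ihφ ihψ =>
    simpa only [DFormula.sat_or_iff] using ihφ.or ihψ
  | ex φ ih =>
    simpa only [DFormula.sat_ex_iff] using ih.quantify fun _ => esoExpressible_existsQuantifier_one
  | all φ ih =>
    simpa only [DFormula.sat_all_iff] using ih.quantify fun _ => esoExpressible_forallQuantifier_one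
  | quant i φ ih =>
    simpa only [DFormula.sat_quant_iff] using ih.quantify fun _ => esoExpressible_apply i

theorem DFormula.exists_esoFormula (ψ : DFormula k ι L 0) :
    ∃ φ : ESOFormula k ι L 0, ∀ (M : Type u) [L.Structure M], ψ.TrueIn Q M ↔ φ.TrueIn Q M := by
  let R : (L.sum (relVar 0)).Relations 0 := .inr .sym
  obtain ⟨φ, hφ⟩ := ((ESODefinable.mem_relTeam R id).and
    (ψ.teamESODefinable Q FirstOrder.Language.LHom.sumInl R)).exRel
  refine ⟨φ, fun M S => Iff.symm <| (hφ M S _).trans ⟨?_, fun h => ⟨{Fin.elim0}, rfl, h⟩⟩⟩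
  rintro ⟨X, hX, h⟩
  exact h.mono (Set.singleton_subset_iff.2 hX)

end DFormula

/-! ### Negation normal form -/

theorem GenQuantifier.compl_mem_dual {k : ℕ} (Q : GenQuantifier.{u} k) {M : Type u}
    {A : Set (Fin k → M)} : Aᶜ ∈ Q.dual M ↔ A ∉ Q M := by
  constructor
  · rintro ⟨B, hB, h⟩
    rwa [compl_injective h]
  · exact fun h => ⟨A, h, rfl⟩

theorem GenQuantifier.Mono.dual {k : ℕ} {Q : GenQuantifier.{u} k} (hQ : Q.Mono) :
    Q.dual.Mono := by
  intro M A B hAB hA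
  rw [← compl_compl A, compl_mem_dual] at hA
  rw [← compl_compl B, compl_mem_dual]
  exact fun hB => hA (hQ M _ _ (Set.compl_subset_compl.2 hAB) hB)

theorem FOFormula.esoDefinable {k : ℕ} {ι κ : Type} {Q : ι → GenQuantifier.{u} k}
    {R : κ → GenQuantifier.{u} k} {pos neg : ι → κ} (hpos : ∀ i, R (pos i) = Q i)
    (hneg : ∀ i, R (neg i) = (Q i).dual) {L : FirstOrder.Language.{v, w}} {n : ℕ}
    (χ : FOFormula k ι L n) :
    ESODefinable R L n (fun _ S s => χ.Sat Q S s) ∧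
      ESODefinable R L n (fun _ S s => ¬ χ.Sat Q S s) := by
  induction χ with
  | atom a => exact ⟨.atom a, .natom a⟩
  | neg φ ih => exact ⟨ih.2, ih.1.congr fun _ _ _ => not_not.symm⟩
  | and φ ψ ihφ ihψ =>
    exact ⟨ihφ.1.and ihψ.1, (ihφ.2.or ihψ.2).congr fun _ _ _ => not_and_or.symm⟩
  | or φ ψ ihφ ihψ =>
    exact ⟨ihφ.1.or ihψ.1, (ihφ.2.and ihψ.2).congr fun _ _ _ => not_or.symm⟩
  | ex φ ih => exact ⟨ih.1.ex, ih.2.all.congr fun _ _ _ => not_exists.symm⟩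
  | all φ ih => exact ⟨ih.1.all, ih.2.ex.congr fun _ _ _ => not_forall.symm⟩
  | quant i φ ih =>
    exact ⟨(esoExpressible_apply (pos i) ih.1).congr fun _ _ _ => by rw [hpos]; rfl,
      (esoExpressible_apply (neg i) ih.2).congr fun _ _ _ => by
        rw [hneg]
        exact (Q i).compl_mem_dual⟩

/-! ### Definability in dependence logic -/

/-- The property `P` is closed under subteams and, however the variables in `V` are represented by
the variables of a formula, it is expressed by a formula of `D(Q_i : i ∈ ι)`. Only nonempty
structures are considered. -/
structure DDefinable {k : ℕ} {ι : Type} (Q : ι → GenQuantifier.{u} k)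
    (L : FirstOrder.Language.{v, w}) (V : Type) (P : TeamProperty.{u} L V) : Prop where
  mono : ∀ {M : Type u} [Nonempty M] {S : L.Structure M} {X Y : Set (V → M)},
    X ⊆ Y → P M S Y → P M S X
  formula : ∀ {N : ℕ} (e : V → Fin N), ∃ ψ : DFormula k ι L N,
    ∀ (M : Type u) [Nonempty M] (S : L.Structure M) (X : Set (Fin N → M)),
      ψ.Sat Q S X ↔ P M S ((· ∘ e) '' X)

/-- The monotone quantifier `U`, acting on teams by extension, is expressible in
`D(Q_i : i ∈ ι)`. -/
structure DExpressible {k : ℕ} {ι : Type} (Q : ι → GenQuantifier.{u} k)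
    (L : FirstOrder.Language.{v, w}) {r : ℕ} (U : GenQuantifier.{u} r) : Prop where
  mono : U.Mono
  formula : ∀ {n : ℕ} (φ : DFormula k ι L (n + r)), ∃ ψ : DFormula k ι L n,
    ∀ (M : Type u) (S : L.Structure M) (X : Set (Fin n → M)),
      ψ.Sat Q S X ↔ ∃ X', TeamExt U X X' ∧ φ.Sat Q S X'

section DExpressible

variable {k : ℕ} {ι : Type} {Q : ι → GenQuantifier.{u} k} {L : FirstOrder.Language.{v, w}}
  {r : ℕ}

theorem dExpressible_apply {i : ι} (hQ : (Q i).Mono) : DExpressible Q L (Q i) :=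
  ⟨hQ, fun φ => ⟨.quant i φ, fun _ _ _ => DFormula.sat_quant_iff⟩⟩

theorem DExpressible.of_zero {U : GenQuantifier.{u} 0} (hU : U.Mono)
    (h : ∀ {M : Type u} {n : ℕ} {p : (Fin n → M) → Prop} {s : Fin n → M},
      {a : Fin 0 → M | p (Fin.append s a)} ∈ U M ↔ p s) : DExpressible Q L U := by
  refine ⟨hU, fun φ => ⟨φ, fun M S X => ⟨fun hφ => ⟨X, fun s hs => h.2 hs, hφ⟩, ?_⟩⟩⟩
  rintro ⟨X', hX', hφ⟩
  exact hφ.mono fun s hs => h.1 (hX' s hs)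

theorem DExpressible.comp {U : GenQuantifier.{u} r} {T : GenQuantifier.{u} 1}
    (hU : DExpressible Q L U) (hT : DExpressible Q L T) : DExpressible Q L (U.comp T) := by
  refine ⟨hU.mono.comp hT.mono, fun {n} φ => ?_⟩
  obtain ⟨χ, hχ⟩ := hT.formula (n := n + r) φ
  obtain ⟨ψ, hψ⟩ := hU.formula χ
  refine ⟨ψ, fun M S X => ?_⟩
  simp only [hψ, hχ]
  constructor
  · rintro ⟨X', hX', X'', hX'', h⟩
    exact ⟨X'', (teamExt_comp hU.mono).2 ⟨X', hX', hX''⟩, h⟩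
  · rintro ⟨X'', hX'', h⟩
    obtain ⟨X', hX', hX''⟩ := (teamExt_comp hU.mono).1 hX''
    exact ⟨X', hX', X'', hX'', h⟩

theorem dExpressible_existsQuantifier : ∀ r, DExpressible Q L (existsQuantifier.{u} r)
  | 0 => .of_zero existsQuantifier_mono append_mem_existsQuantifier_zero
  | r + 1 => existsQuantifier_comp ▸ (dExpressible_existsQuantifier r).comp
      ⟨existsQuantifier_mono, fun φ => ⟨.ex φ, fun _ _ _ => DFormula.sat_ex_iff⟩⟩

theorem dExpressible_forallQuantifier : ∀ r, DExpressible Q L (forallQuantifier.{u} r)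
  | 0 => .of_zero forallQuantifier_mono append_mem_forallQuantifier_zero
  | r + 1 => forallQuantifier_comp ▸ (dExpressible_forallQuantifier r).comp
      ⟨forallQuantifier_mono, fun φ => ⟨.all φ, fun _ _ _ => DFormula.sat_all_iff⟩⟩

end DExpressible

section Equalizers

theorem exists_forall_eq_iff {α M : Type*} [Nontrivial M] (p : α → Prop) :
    ∃ g₁ g₂ : α → M, ∀ w, g₁ w = g₂ w ↔ p w := by
  classical
  obtain ⟨a, b, hab⟩ := exists_pair_ne M
  refine ⟨fun _ => a, fun w => if p w then a else b, fun w => ?_⟩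
  by_cases hw : p w <;> simp [hw, hab]

theorem exists_pred_iff_exists_eq {W M : Type*} [Nonempty M] {p : ((W → M) → Prop) → Prop} :
    (∃ R, p R) ↔ (∃ g₂ g₁ : (W → M) → M, p fun w => g₁ w = g₂ w) ∨ p fun _ => False := by
  refine ⟨fun ⟨R, hR⟩ => ?_, fun h => h.elim (fun ⟨_, _, h⟩ => ⟨_, h⟩) fun h => ⟨_, h⟩⟩
  rcases subsingleton_or_nontrivial M with _ | _
  · obtain ⟨w₀⟩ : Nonempty (W → M) := inferInstance
    have eq_const : R = fun _ => R w₀ := funext fun w => congrArg R (Subsingleton.elim w w₀)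
    rw [eq_const] at hR
    by_cases h : R w₀
    · exact .inl ⟨fun _ => Classical.arbitrary M, fun _ => Classical.arbitrary M,
        by simpa only [eq_self, eq_true h] using hR⟩
    · exact .inr (by simpa only [eq_false h] using hR)
  · obtain ⟨g₁, g₂, hg⟩ := exists_forall_eq_iff (M := M) R
    exact .inl ⟨g₂, g₁, by simpa only [hg] using hR⟩

end Equalizers

section DDefinable

variable {k : ℕ} {ι : Type} {Q : ι → GenQuantifier.{u} k} {L : FirstOrder.Language.{v, w}}
  {V V' W : Type} {P P' : TeamProperty.{u} L V}

theorem DDefinable.congr (hP : DDefinable Q L V P)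
    (h : ∀ (M : Type u) [Nonempty M] S X, P M S X ↔ P' M S X) : DDefinable Q L V P' where
  mono hXY hY := (h _ _ _).1 (hP.mono hXY ((h _ _ _).2 hY))
  formula e :=
    let ⟨ψ, hψ⟩ := hP.formula e
    ⟨ψ, fun M _ S X => (hψ M S X).trans (h _ _ _)⟩

theorem DDefinable.comap {P : TeamProperty.{u} L V'} (hP : DDefinable Q L V' P) (σ : V' → V) :
    DDefinable Q L V fun M S X => P M S ((· ∘ σ) '' X) where
  mono hXY hY := hP.mono (Set.image_mono hXY) hY
  formula e := by
    obtain ⟨ψ, hψ⟩ := hP.formula (e ∘ σ)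
    refine ⟨ψ, fun M _ S X => ?_⟩
    rw [hψ, Set.image_image]
    rfl

theorem DDefinable.and (hP : DDefinable Q L V P) (hP' : DDefinable Q L V P') :
    DDefinable Q L V fun M S X => P M S X ∧ P' M S X where
  mono hXY hY := ⟨hP.mono hXY hY.1, hP'.mono hXY hY.2⟩
  formula e :=
    let ⟨ψ, hψ⟩ := hP.formula e
    let ⟨ψ', hψ'⟩ := hP'.formula e
    ⟨.and ψ ψ', fun M _ S X => and_congr (hψ M S X) (hψ' M S X)⟩

theorem DDefinable.or (hP : DDefinable Q L V P) (hP' : DDefinable Q L V P') :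
    DDefinable Q L V fun M S X => ∃ Y Z, X ⊆ Y ∪ Z ∧ P M S Y ∧ P' M S Z where
  mono := fun hXY ⟨Y, Z, h, hY, hZ⟩ => ⟨Y, Z, hXY.trans h, hY, hZ⟩
  formula e := by
    obtain ⟨ψ, hψ⟩ := hP.formula e
    obtain ⟨ψ', hψ'⟩ := hP'.formula e
    refine ⟨.or ψ ψ', fun M _ S X => ?_⟩
    simp only [DFormula.sat_or_iff, hψ, hψ']
    constructor
    · rintro ⟨Y, Z, h, hY, hZ⟩
      exact ⟨_, _, (Set.image_mono h).trans (Set.image_union _ _ _).le, hY, hZ⟩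
    · rintro ⟨Y, Z, h, hY, hZ⟩
      exact ⟨(· ∘ e) ⁻¹' Y, (· ∘ e) ⁻¹' Z, fun x hx => h ⟨x, hx, rfl⟩,
        hP.mono (Set.image_preimage_subset _ _) hY, hP'.mono (Set.image_preimage_subset _ _) hZ⟩

theorem DDefinable.forall_and {J : Type} [Finite J] {R : J → TeamProperty.{u} L V}
    (hR : ∀ j, DDefinable Q L V (R j)) (hP : DDefinable Q L V P) :
    DDefinable Q L V fun M S X => (∀ j, R j M S X) ∧ P M S X := by
  induction J using Finite.induction_empty_option with
  | of_equiv e ih =>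
    exact (ih fun j => hR (e j)).congr fun _ _ _ _ =>
      and_congr_left' (e.forall_congr_right (q := fun j => R j _ _ _))
  | h_empty => exact hP.congr fun _ _ _ _ => (and_iff_right isEmptyElim).symm
  | h_option ih =>
    exact ((hR none).and (ih fun j => hR (some j))).congr fun _ _ _ _ => by
      rw [Option.forall, and_assoc]

theorem DDefinable.quantify {r : ℕ} {U : GenQuantifier.{u} r} (hU : DExpressible Q L U)
    {P : TeamProperty.{u} L (V ⊕ V')} (hP : DDefinable Q L (V ⊕ V') P) (v : V' → Fin r) :
    DDefinable Q L V fun M S X =>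
      ∃ X' : Set (V ⊕ V' → M), (∀ x ∈ X, {a | Sum.elim x (a ∘ v) ∈ X'} ∈ U M) ∧ P M S X' where
  mono := fun hXY ⟨X', hX', h⟩ => ⟨X', fun x hx => hX' x (hXY hx), h⟩
  formula {N} e := by
    let e' : V ⊕ V' → Fin (N + r) := Sum.elim (Fin.castAdd r ∘ e) (Fin.natAdd N ∘ v)
    have append_comp_e' {M : Type u} (y : Fin N → M) (a : Fin r → M) :
        Fin.append y a ∘ e' = Sum.elim (y ∘ e) (a ∘ v) := by
      simp only [e', Sum.comp_elim, ← Function.comp_assoc, append_comp_castAdd, append_comp_natAdd]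
    obtain ⟨φ, hφ⟩ := hP.formula e'
    obtain ⟨ψ, hψ⟩ := hU.formula φ
    refine ⟨ψ, fun M _ S X => ?_⟩
    simp only [hψ, hφ]
    constructor
    · rintro ⟨X', hX', h⟩
      refine ⟨_, Set.forall_mem_image.2 fun y hy => ?_, h⟩
      exact hU.mono _ _ _ (fun a ha => ⟨_, ha, append_comp_e' y a⟩) (hX' y hy)
    · rintro ⟨X', hX', h⟩
      refine ⟨_, fun y hy => ?_, hP.mono (Set.image_preimage_subset _ X') h⟩
      simp only [Set.mem_preimage, append_comp_e']
      exact hX' _ ⟨y, hy, rfl⟩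

theorem DDefinable.alls [Finite V'] {P : TeamProperty.{u} L (V ⊕ V')}
    (hP : DDefinable Q L (V ⊕ V') P) :
    DDefinable Q L V fun M S X => P M S (Set.image2 Sum.elim X Set.univ) := by
  obtain ⟨r, ⟨v⟩⟩ := Finite.exists_equiv_fin V'
  refine (hP.quantify (dExpressible_forallQuantifier r) v).congr fun M _ S X => ⟨?_, fun h => ?_⟩
  · rintro ⟨X', hX', h⟩
    refine hP.mono (Set.image2_subset_iff.2 fun x hx b _ => ?_) h
    simpa [Function.comp_assoc] using mem_forallQuantifier.1 (hX' x hx) (b ∘ v.symm)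
  · exact ⟨Set.image2 Sum.elim X Set.univ, fun x hx => mem_forallQuantifier.2 fun a =>
      Set.mem_image2_of_mem hx (Set.mem_univ (a ∘ v)), h⟩

theorem DDefinable.dep [Finite W] (key : W → V) (v : V) :
    DDefinable Q L V fun _ _ X => ∀ x ∈ X, ∀ x' ∈ X, x ∘ key = x' ∘ key → x v = x' v where
  mono := fun hXY h x hx x' hx' => h x (hXY hx) x' (hXY hx')
  formula e := by
    obtain ⟨r, ⟨f⟩⟩ := Finite.exists_equiv_fin W
    refine ⟨.dep (fun i => .var (e (key (f.symm i)))) (.var (e v)), fun M _ S X => ?_⟩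
    simp only [DFormula.Sat, Set.forall_mem_image, FirstOrder.Language.Term.realize_var,
      funext_iff, Function.comp_apply, f.symm.forall_congr_left, Equiv.symm_symm,
      Equiv.symm_apply_apply]

theorem DDefinable.atom {n : ℕ} (a : Atom L n) (σ : Fin n → V) :
    DDefinable Q L V fun _ S X => ∀ x ∈ X, a.Holds S (x ∘ σ) where
  mono := fun hXY h x hx => h x (hXY hx)
  formula e := by
    refine ⟨.atom (a.relabel (e ∘ σ)), fun M _ S X => ?_⟩
    simp only [DFormula.Sat, Set.forall_mem_image, Atom.holds_relabel, Function.comp_assoc]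

theorem DDefinable.natom {n : ℕ} (a : Atom L n) (σ : Fin n → V) :
    DDefinable Q L V fun _ S X => ∀ x ∈ X, ¬ a.Holds S (x ∘ σ) where
  mono := fun hXY h x hx => h x (hXY hx)
  formula e := by
    refine ⟨.natom (a.relabel (e ∘ σ)), fun M _ S X => ?_⟩
    simp only [DFormula.Sat, Set.forall_mem_image, Atom.holds_relabel, Function.comp_assoc]

theorem DDefinable.varEq (v v' : V) : DDefinable Q L V fun _ _ X => ∀ x ∈ X, x v = x v' :=
  .atom (n := 2) (.eq (.var 0) (.var 1)) ![v, v']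

theorem DDefinable.varNe (v v' : V) : DDefinable Q L V fun _ _ X => ∀ x ∈ X, x v ≠ x v' :=
  .natom (n := 2) (.eq (.var 0) (.var 1)) ![v, v']

theorem DDefinable.flat_or {A B : ∀ M : Type u, L.Structure M → (V → M) → Prop}
    (hA : DDefinable Q L V fun M S X => ∀ x ∈ X, A M S x)
    (hB : DDefinable Q L V fun M S X => ∀ x ∈ X, B M S x) :
    DDefinable Q L V fun M S X => ∀ x ∈ X, A M S x ∨ B M S x := by
  refine (hA.or hB).congr fun M _ S X => ⟨?_, fun h => ⟨{x | A M S x}, {x | B M S x}, h,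
    fun x hx => hx, fun x hx => hx⟩⟩
  rintro ⟨Y, Z, h, hY, hZ⟩ x hx
  exact (h hx).imp (hY x) (hZ x)

theorem DDefinable.flat_imp_varEq (v v' : V) : ∀ {r : ℕ} (a b : Fin r → V),
    DDefinable Q L V fun _ _ X => ∀ x ∈ X, x ∘ a = x ∘ b → x v = x v'
  | 0, a, b => (DDefinable.varEq v v').congr fun _ _ _ _ =>
      forall₂_congr fun x _ => (imp_iff_right (Subsingleton.elim (x ∘ a) (x ∘ b))).symm
  | r + 1, a, b =>
    (DDefinable.flat_or (A := fun _ _ x => x (a 0) ≠ x (b 0)) (.varNe (a 0) (b 0))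
      (.flat_imp_varEq v v' (a ∘ Fin.succ) (b ∘ Fin.succ))).congr fun _ _ _ _ =>
      forall₂_congr fun x _ => by
        rw [← imp_iff_not_or, ← and_imp]
        simp only [funext_iff, Fin.forall_fin_succ, Function.comp_apply]

/-- Functions of the values of `key` are quantified by means of dependence atoms. -/
theorem DDefinable.exists_fun [Finite W] [Finite V'] (key : W → V)
    {P : TeamProperty.{u} L (V ⊕ V')} (hP : DDefinable Q L (V ⊕ V') P) :
    DDefinable Q L V fun M S X => ∃ g : (W → M) → V' → M,
      P M S ((fun x => Sum.elim x (g (x ∘ key))) '' X) := by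
  obtain ⟨r, ⟨v⟩⟩ := Finite.exists_equiv_fin V'
  have hdep : DDefinable Q L (V ⊕ V') _ :=
    .forall_and (fun j => .dep (Sum.inl ∘ key) (Sum.inr j)) hP
  refine (hdep.quantify (dExpressible_existsQuantifier r) v).congr fun M _ S X => ⟨?_, ?_⟩
  · rintro ⟨X', hX', hdep, h⟩
    choose a ha using hX'
    have hex (w : W → M) : ∃ b : V' → M, ∀ x (hx : x ∈ X), x ∘ key = w → a x hx ∘ v = b := by
      by_cases hw : ∃ x ∈ X, x ∘ key = w
      · obtain ⟨x, hx, rfl⟩ := hw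
        exact ⟨a x hx ∘ v, fun x' hx' hk => funext fun j =>
          hdep j _ (ha x' hx') _ (ha x hx) hk⟩
      · exact ⟨fun _ => Classical.arbitrary M, fun x hx hk => (hw ⟨x, hx, hk⟩).elim⟩
    choose g hg using hex
    refine ⟨g, hP.mono (Set.image_subset_iff.2 fun x hx => ?_) h⟩
    rw [Set.mem_preimage, ← hg _ x hx rfl]
    exact ha x hx
  · rintro ⟨g, h⟩
    refine ⟨(fun x => Sum.elim x (g (x ∘ key))) '' X,
      fun x hx => ⟨g (x ∘ key) ∘ v.symm, x, hx, ?_⟩, fun j => ?_, h⟩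
    · simp only [Function.comp_assoc, Equiv.symm_comp_self, Function.comp_id]
    · rintro _ ⟨x, -, rfl⟩ _ ⟨x', -, rfl⟩ hk
      exact congrFun (congrArg g hk) j

theorem DDefinable.ite {A : ∀ M : Type u, L.Structure M → (V → M) → Prop}
    (hA : DDefinable Q L V fun M S X => ∀ x ∈ X, A M S x)
    (hA' : DDefinable Q L V fun M S X => ∀ x ∈ X, ¬ A M S x)
    (hP : DDefinable Q L V P) (hP' : DDefinable Q L V P') :
    DDefinable Q L V fun M S X => P M S {x ∈ X | A M S x} ∧ P' M S {x ∈ X | ¬ A M S x} := by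
  refine ((hA.and hP).or (hA'.and hP')).congr fun M _ S X => ⟨?_, fun h => ?_⟩
  · rintro ⟨Y, Z, h, ⟨hAY, hY⟩, ⟨hAZ, hZ⟩⟩
    exact ⟨hP.mono (fun x hx => (h hx.1).resolve_right fun hxZ => hAZ x hxZ hx.2) hY,
      hP'.mono (fun x hx => (h hx.1).resolve_left fun hxY => hx.2 (hAY x hxY)) hZ⟩
  · exact ⟨{x ∈ X | A M S x}, {x ∈ X | ¬ A M S x},
      fun x hx => (em (A M S x)).imp (fun h => ⟨hx, h⟩) (fun h => ⟨hx, h⟩),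
      ⟨fun x hx => hx.2, h.1⟩, ⟨fun x hx => hx.2, h.2⟩⟩

theorem DDefinable.subsingleton_of_nonempty :
    DDefinable Q L V fun M _ X => X.Nonempty → Subsingleton M := by
  refine (DDefinable.varEq (V := V ⊕ Fin 2) (.inr 0) (.inr 1)).alls.congr fun M _ S X => ?_
  simp only [Set.forall_mem_image2, Set.mem_univ, forall_const, Sum.elim_inr]
  exact ⟨fun h ⟨x, hx⟩ => ⟨fun a b => h x hx ![a, b]⟩,
    fun h x hx a => (h ⟨x, hx⟩).elim _ _⟩

theorem DDefinable.exists_equalizer [Finite W] (key : W → V) (hP : DDefinable Q L V P)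
    (hP' : DDefinable Q L V P') :
    DDefinable Q L V fun M S X => ∃ g : (W → M) → Fin 2 → M,
      P M S {x ∈ X | g (x ∘ key) 0 = g (x ∘ key) 1} ∧
        P' M S {x ∈ X | g (x ∘ key) 0 ≠ g (x ∘ key) 1} := by
  have image_sep {M : Type u} (X : Set (V → M)) (g : (W → M) → Fin 2 → M) (p : (Fin 2 → M) → Prop) :
      (· ∘ Sum.inl) '' {y ∈ (fun x => Sum.elim x (g (x ∘ key))) '' X | p (y ∘ Sum.inr)} =
        {x ∈ X | p (g (x ∘ key))} := by
    ext x
    constructor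
    · rintro ⟨_, ⟨⟨x, hx, rfl⟩, hp⟩, rfl⟩
      exact ⟨hx, hp⟩
    · exact fun ⟨hx, hp⟩ => ⟨_, ⟨⟨x, hx, rfl⟩, hp⟩, rfl⟩
  let v (i : Fin 2) : V ⊕ Fin 2 := Sum.inr i
  refine ((DDefinable.ite (.varEq (v 0) (v 1)) (.varNe (v 0) (v 1))
    (hP.comap (Sum.inl (β := Fin 2))) (hP'.comap Sum.inl)).exists_fun key).congr
    fun M _ S X => exists_congr fun g => ?_
  exact and_congr (iff_of_eq (congrArg (P M S) (image_sep X g fun b => b 0 = b 1)))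
    (iff_of_eq (congrArg (P' M S) (image_sep X g fun b => b 0 ≠ b 1)))

/-- In a structure with two elements every set of values is an equalizer; in a one-element
structure the empty set is not, and the second disjunct takes care of it. -/
theorem DDefinable.sep [Finite W] (key : W → V) (hP : DDefinable Q L V P)
    (hP' : DDefinable Q L V P') :
    DDefinable Q L V fun M S X => ∃ B : Set (W → M),
      P M S {x ∈ X | x ∘ key ∈ B} ∧ P' M S {x ∈ X | x ∘ key ∉ B} := by
  refine ((hP.exists_equalizer key hP').or (DDefinable.subsingleton_of_nonempty.and hP')).congr
    fun M _ S X => ⟨?_, ?_⟩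
  · rintro ⟨Y, Z, hX, ⟨g, hY, hY'⟩, hM, hZ⟩
    by_cases hXY : X ⊆ Y
    · refine ⟨{w | g w 0 = g w 1}, hP.mono ?_ hY, hP'.mono ?_ hY'⟩ <;>
        exact fun x hx => ⟨hXY hx.1, hx.2⟩
    · obtain ⟨x, hx, hxY⟩ := Set.not_subset.1 hXY
      have hxZ := (hX hx).resolve_left hxY
      have := hM ⟨x, hxZ⟩
      exact ⟨∅, hP.mono (fun _ hx => hx.2.elim) hY,
        hP'.mono (fun y _ => Subsingleton.elim x y ▸ hxZ) hZ⟩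
  · rintro ⟨B, hB, hB'⟩
    rcases subsingleton_or_nontrivial M with hM | hM
    · refine ⟨{x ∈ X | x ∘ key ∈ B}, {x ∈ X | x ∘ key ∉ B}, fun x hx => ?_,
        ⟨fun _ _ => Classical.arbitrary M, ?_, ?_⟩, fun _ => hM, hB'⟩
      · exact (em (x ∘ key ∈ B)).imp (fun h => ⟨hx, h⟩) (fun h => ⟨hx, h⟩)
      · exact hP.mono (fun x hx => hx.1) hB
      · exact hP'.mono (fun x hx => (hx.2 rfl).elim) hB'
    · obtain ⟨g₁, g₂, hg⟩ := exists_forall_eq_iff (M := M) (· ∈ B)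
      refine ⟨X, ∅, Set.subset_union_left, ⟨fun w => ![g₁ w, g₂ w], ?_⟩,
        fun h => (Set.not_nonempty_empty h).elim, hP'.mono (Set.empty_subset _) hB'⟩
      simpa [hg] using ⟨hB, hB'⟩

end DDefinable

/-! ### Graphs of functions as teams -/

/-- A family of functions of the arities `ρ i`, the values of second-order variables. -/
abbrev FunEnv {P : Type} (ρ : P → ℕ) (M : Type u) : Type u := ∀ i, (Fin (ρ i) → M) → M

/-- The family `f` with one more function. -/
def FunEnv.cons {P : Type} {ρ : P → ℕ} {M : Type u} {m : ℕ} (g : (Fin m → M) → M)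
    (f : FunEnv ρ M) : FunEnv (Option.elim · m ρ) M
  | none => g
  | some i => f i

/-- Variables for the arguments of functions of the arities `ρ i`. -/
abbrev ArgVar {P : Type} (ρ : P → ℕ) : Type := Σ i, Fin (ρ i)

/-- The variables in `V` with variables for arguments and values of functions of the arities
`ρ i`. -/
abbrev GraphVar {P : Type} (V : Type) (ρ : P → ℕ) : Type := V ⊕ (ArgVar ρ ⊕ P)

/-- The assignment `x` extended by the arguments `z` and the values of the functions `f` there. -/
def graphRow {P V : Type} {ρ : P → ℕ} {M : Type u} (x : V → M) (f : FunEnv ρ M)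
    (z : ArgVar ρ → M) : GraphVar V ρ → M :=
  Sum.elim x (Sum.elim z fun i => f i fun j => z ⟨i, j⟩)

/-- The team that lists, for every `x ∈ X`, the graphs of the functions `f x`. -/
def graphTeam {P V : Type} {ρ : P → ℕ} {M : Type u} (X : Set (V → M))
    (f : (V → M) → FunEnv ρ M) : Set (GraphVar V ρ → M) :=
  {y | ∃ x ∈ X, ∃ z, graphRow x (f x) z = y}

/-- A property of structures with functions of the arities `ρ i` and an assignment of the variables
in `V`. -/
abbrev FunProperty {P : Type} (L : FirstOrder.Language.{v, w}) (ρ : P → ℕ) (V : Type) :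
    Type (max (u + 1) v w) :=
  ∀ M : Type u, L.Structure M → FunEnv ρ M → (V → M) → Prop

/-- Among the teams that list graphs of functions, some property definable in `D(Q_i : i ∈ ι)`
singles out those in which all assignments, taken together with their functions, have the
property `A`. -/
def FlatlyDefinable {k : ℕ} {ι : Type} (Q : ι → GenQuantifier.{u} k)
    (L : FirstOrder.Language.{v, w}) {P : Type} (ρ : P → ℕ) (V : Type)
    (A : FunProperty.{u} L ρ V) : Prop :=
  ∃ T, DDefinable Q L (GraphVar V ρ) T ∧ ∀ (M : Type u) [Nonempty M] (S : L.Structure M)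
    (X : Set (V → M)) (f : (V → M) → FunEnv ρ M), T M S (graphTeam X f) ↔ ∀ x ∈ X, A M S (f x) x

section GraphTeam

variable {P P' V V' : Type} {ρ : P → ℕ} {M : Type u} {X : Set (V → M)}
  {f : (V → M) → FunEnv ρ M}

theorem forall_mem_graphTeam {p : (GraphVar V ρ → M) → Prop} :
    (∀ y ∈ graphTeam X f, p y) ↔ ∀ x ∈ X, ∀ z, p (graphRow x (f x) z) :=
  ⟨fun h x hx z => h _ ⟨x, hx, z, rfl⟩, fun h _ ⟨x, hx, z, hy⟩ => hy ▸ h x hx z⟩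

theorem graphTeam_sep (B : Set (V → M)) :
    {y ∈ graphTeam X f | y ∘ Sum.inl ∈ B} = graphTeam {x ∈ X | x ∈ B} f := by
  ext y
  constructor
  · rintro ⟨⟨x, hx, z, rfl⟩, hB⟩
    exact ⟨x, ⟨hx, hB⟩, z, rfl⟩
  · rintro ⟨x, ⟨hx, hB⟩, z, rfl⟩
    exact ⟨⟨x, hx, z, rfl⟩, hB⟩

theorem image_graphTeam_reindex (σ : V' ≃ V) :
    (· ∘ Sum.map σ id) '' graphTeam X f =
      graphTeam ((· ∘ σ) '' X) fun x => f (x ∘ σ.symm) := by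
  have row_comp (x : V → M) (z : ArgVar ρ → M) :
      graphRow x (f x) z ∘ Sum.map σ id = graphRow (x ∘ σ) (f ((x ∘ σ) ∘ σ.symm)) z := by
    rw [Function.comp_assoc, Equiv.self_comp_symm, Function.comp_id]
    exact Sum.elim_comp_map ..
  ext y
  constructor
  · rintro ⟨_, ⟨x, hx, z, rfl⟩, rfl⟩
    exact ⟨x ∘ σ, ⟨x, hx, rfl⟩, z, (row_comp x z).symm⟩
  · rintro ⟨_, ⟨x, hx, rfl⟩, z, rfl⟩
    exact ⟨_, ⟨x, hx, z, rfl⟩, row_comp x z⟩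

theorem image_graphTeam_weaken [Nonempty M] {e : P' → P} (he : e.Injective) :
    (· ∘ Sum.map id (Sum.map (Sigma.map e fun _ => id) e)) '' graphTeam X f =
      graphTeam (ρ := ρ ∘ e) X fun x i => f x (e i) := by
  have row_comp (x : V → M) (z : ArgVar ρ → M) :
      graphRow x (f x) z ∘ Sum.map id (Sum.map (Sigma.map e fun _ => id) e) =
        graphRow (ρ := ρ ∘ e) x (fun i => f x (e i)) (z ∘ Sigma.map e fun _ => id) := by
    simp only [graphRow, Sum.elim_comp_map, Function.comp_id]
    rfl
  ext y
  constructor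
  · rintro ⟨_, ⟨x, hx, z, rfl⟩, rfl⟩
    exact ⟨x, hx, _, (row_comp x z).symm⟩
  · rintro ⟨x, hx, z, rfl⟩
    have injective_sigmaMap : (Sigma.map e fun _ => id : ArgVar (ρ ∘ e) → ArgVar ρ).Injective :=
      he.sigma_map fun _ => Function.injective_id
    obtain ⟨z, rfl⟩ := injective_sigmaMap.surjective_comp_right z
    exact ⟨_, ⟨x, hx, z, rfl⟩, row_comp x z⟩

/-- The place of a variable for the graphs of `FunEnv.cons g f` among the variables for the graphs
of `f`, for the arguments of `g` and for its value. -/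
def consVar {m : ℕ} : GraphVar V (Option.elim · m ρ) → (GraphVar V ρ ⊕ Fin m) ⊕ Unit
  | .inl v => .inl (.inl (.inl v))
  | .inr (.inl ⟨none, j⟩) => .inl (.inr j)
  | .inr (.inl ⟨some i, j⟩) => .inl (.inl (.inr (.inl ⟨i, j⟩)))
  | .inr (.inr none) => .inr ()
  | .inr (.inr (some i)) => .inl (.inl (.inr (.inr i)))

theorem image_graphTeam_cons {m : ℕ} (g : (V ⊕ Fin m → M) → Unit → M) :
    (· ∘ consVar) '' ((fun y => Sum.elim y (g (y ∘ Sum.map Sum.inl id))) ''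
        Set.image2 Sum.elim (graphTeam X f) Set.univ) =
      graphTeam X fun x => FunEnv.cons (fun w => g (Sum.elim x w) ()) (f x) := by
  have row_comp (x : V → M) (z : ArgVar (Option.elim · m ρ) → M) :
      Sum.elim (Sum.elim (graphRow x (f x) fun p => z ⟨some p.1, p.2⟩) fun j => z ⟨none, j⟩)
          (g (Sum.elim x fun j => z ⟨none, j⟩)) ∘ consVar =
        graphRow x (FunEnv.cons (fun w => g (Sum.elim x w) ()) (f x)) z := by
    funext v
    rcases v with v | ⟨_ | i, j⟩ | _ | i <;> rfl
  have row_key (x : V → M) z (w : Fin m → M) :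
      Sum.elim (graphRow x (f x) z) w ∘ Sum.map Sum.inl id = Sum.elim x w := Sum.elim_comp_map ..
  ext y
  constructor
  · rintro ⟨_, ⟨_, ⟨_, ⟨x, hx, z, rfl⟩, w, -, rfl⟩, rfl⟩, rfl⟩
    refine ⟨x, hx, fun | ⟨none, j⟩ => w j | ⟨some i, j⟩ => z ⟨i, j⟩, ?_⟩
    simp only [← row_comp, row_key]
    rfl
  · rintro ⟨x, hx, z, rfl⟩
    refine ⟨_, ⟨_, ⟨_, ⟨x, hx, fun p => z ⟨some p.1, p.2⟩, rfl⟩,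
      fun j => z ⟨none, j⟩, trivial, rfl⟩, rfl⟩, ?_⟩
    simp only [row_key]
    exact row_comp x z

theorem exists_arg_eq [Nonempty M] (i : P) (a : Fin (ρ i) → M) :
    ∃ z : ArgVar ρ → M, (fun j => z ⟨i, j⟩) = a := by
  classical
  exact ⟨fun p => Function.update (β := fun i => Fin (ρ i) → M)
    (fun _ _ => Classical.arbitrary M) i a p.1 p.2,
    by simp only [Function.update_self]⟩

end GraphTeam

section FlatlyDefinable

variable {k : ℕ} {ι : Type} {Q : ι → GenQuantifier.{u} k} {L : FirstOrder.Language.{v, w}}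
  {P P' V V' : Type} {ρ : P → ℕ} {A B : FunProperty.{u} L ρ V}

theorem FlatlyDefinable.congr (hA : FlatlyDefinable Q L ρ V A)
    (h : ∀ (M : Type u) [Nonempty M] S f x, A M S f x ↔ B M S f x) : FlatlyDefinable Q L ρ V B :=
  let ⟨T, hT, hTA⟩ := hA
  ⟨T, hT, fun M _ S X f => (hTA M S X f).trans (forall₂_congr fun x _ => h M S (f x) x)⟩

theorem FlatlyDefinable.reindex {A : FunProperty.{u} L ρ V'} (hA : FlatlyDefinable Q L ρ V' A)
    (σ : V' ≃ V) : FlatlyDefinable Q L ρ V fun M S f x => A M S f (x ∘ σ) := by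
  obtain ⟨T, hT, hTA⟩ := hA
  refine ⟨_, hT.comap (Sum.map σ id), fun M _ S X f => ?_⟩
  simp only [image_graphTeam_reindex, hTA, Set.forall_mem_image, Function.comp_assoc,
    Equiv.self_comp_symm, Function.comp_id]

theorem FlatlyDefinable.weaken {e : P' → P} (he : e.Injective) {A : FunProperty.{u} L (ρ ∘ e) V}
    (hA : FlatlyDefinable Q L (ρ ∘ e) V A) :
    FlatlyDefinable Q L ρ V fun M S f x => A M S (fun i => f (e i)) x := by
  obtain ⟨T, hT, hTA⟩ := hA
  refine ⟨_, hT.comap (Sum.map id (Sum.map (Sigma.map e fun _ => id) e)), fun M _ S X f => ?_⟩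
  simp only [image_graphTeam_weaken he, hTA]

theorem FlatlyDefinable.of_forall_mem {B : ∀ M : Type u, L.Structure M → (GraphVar V ρ → M) → Prop}
    (hB : DDefinable Q L (GraphVar V ρ) fun M S Y => ∀ y ∈ Y, B M S y) :
    FlatlyDefinable Q L ρ V fun M S f x => ∀ z, B M S (graphRow x f z) :=
  ⟨_, hB, fun _ _ _ _ _ => forall_mem_graphTeam⟩

theorem FlatlyDefinable.atom {n : ℕ} (a : Atom L n) (σ : Fin n → V) :
    FlatlyDefinable Q L ρ V fun _ S _ x => a.Holds S (x ∘ σ) :=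
  (of_forall_mem (.atom a (Sum.inl ∘ σ))).congr fun M _ S _ x =>
    forall_const (α := ArgVar ρ → M) (b := a.Holds S (x ∘ σ))

theorem FlatlyDefinable.natom {n : ℕ} (a : Atom L n) (σ : Fin n → V) :
    FlatlyDefinable Q L ρ V fun _ S _ x => ¬ a.Holds S (x ∘ σ) :=
  (of_forall_mem (.natom a (Sum.inl ∘ σ))).congr fun M _ S _ x =>
    forall_const (α := ArgVar ρ → M) (b := ¬ a.Holds S (x ∘ σ))

theorem FlatlyDefinable.apply_eq (i : P) (σ : Fin (ρ i) → V) (v : V) :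
    FlatlyDefinable Q L ρ V fun _ _ f x => f i (x ∘ σ) = x v := by
  refine (of_forall_mem (.flat_imp_varEq (Sum.inr (Sum.inr i)) (Sum.inl v)
    (fun j => Sum.inr (Sum.inl ⟨i, j⟩)) (Sum.inl ∘ σ))).congr fun M _ _ f x => ⟨fun h => ?_, ?_⟩
  · obtain ⟨z, hz⟩ := exists_arg_eq i (x ∘ σ)
    exact (congrArg (f i) hz.symm).trans (h z hz)
  · rintro h z hz
    exact (congrArg (f i) hz).trans h

theorem FlatlyDefinable.and (hA : FlatlyDefinable Q L ρ V A) (hB : FlatlyDefinable Q L ρ V B) :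
    FlatlyDefinable Q L ρ V fun M S f x => A M S f x ∧ B M S f x := by
  obtain ⟨T, hT, hTA⟩ := hA
  obtain ⟨T', hT', hTB⟩ := hB
  refine ⟨_, hT.and hT', fun M _ S X f => ?_⟩
  simp only [hTA, hTB, forall_and]

theorem FlatlyDefinable.forall_and {J : Type} [Finite J] {R : J → FunProperty.{u} L ρ V}
    (hR : ∀ j, FlatlyDefinable Q L ρ V (R j)) (hA : FlatlyDefinable Q L ρ V A) :
    FlatlyDefinable Q L ρ V fun M S f x => (∀ j, R j M S f x) ∧ A M S f x := by
  obtain ⟨T, hT, hTA⟩ := hA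
  choose T' hT' hTR using hR
  refine ⟨_, .forall_and hT' hT, fun M _ S X f => ?_⟩
  simp only [hTA, hTR]
  exact ⟨fun h x hx => ⟨fun j => h.1 j x hx, h.2 x hx⟩,
    fun h => ⟨fun j x hx => (h x hx).1 j, fun x hx => (h x hx).2⟩⟩

theorem FlatlyDefinable.or [Finite V] (hA : FlatlyDefinable Q L ρ V A)
    (hB : FlatlyDefinable Q L ρ V B) :
    FlatlyDefinable Q L ρ V fun M S f x => A M S f x ∨ B M S f x := by
  obtain ⟨T, hT, hTA⟩ := hA
  obtain ⟨T', hT', hTB⟩ := hB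
  refine ⟨_, hT.sep Sum.inl hT', fun M _ S X f => ?_⟩
  have graphTeam_sep_not (C : Set (V → M)) : {y ∈ graphTeam X f | y ∘ Sum.inl ∉ C} =
      graphTeam {x ∈ X | x ∉ C} f := graphTeam_sep Cᶜ
  simp only [graphTeam_sep, graphTeam_sep_not, hTA, hTB]
  constructor
  · rintro ⟨C, hC, hC'⟩ x hx
    by_cases hxC : x ∈ C
    · exact Or.inl (hC x ⟨hx, hxC⟩)
    · exact Or.inr (hC' x ⟨hx, hxC⟩)
  · exact fun h => ⟨{x | A M S (f x) x}, fun x hx => hx.2, fun x hx => (h x hx.1).resolve_left hx.2⟩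

theorem FlatlyDefinable.exFun [Finite V] {m : ℕ} {A : FunProperty.{u} L (Option.elim · m ρ) V}
    (hA : FlatlyDefinable Q L (Option.elim · m ρ) V A) :
    FlatlyDefinable Q L ρ V fun M S f x => ∃ g, A M S (FunEnv.cons g f) x := by
  obtain ⟨T, hT, hTA⟩ := hA
  refine ⟨_, ((hT.comap consVar).exists_fun (Sum.map Sum.inl id)).alls, fun M _ S X f => ?_⟩
  simp only [image_graphTeam_cons, hTA]
  constructor
  · exact fun ⟨g, hg⟩ x hx => ⟨_, hg x hx⟩
  · intro h
    choose! g hg using h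
    exact ⟨fun w _ => g (w ∘ Sum.inl) (w ∘ Sum.inr), hg⟩

/-- The graphs of the functions listed by a team are copied to new variables: new arguments range
over all tuples, and a dependence atom makes their values a function `g` of the assignment and the
arguments, which agrees with the listed values. This detaches the graphs from the row in which
the tuple in the variables `V'` was chosen. -/
theorem DDefinable.refresh [Finite V] [Finite P]
    {T : TeamProperty.{u} L (GraphVar (V ⊕ V') ρ)} (hT : DDefinable Q L (GraphVar (V ⊕ V') ρ) T) :
    DDefinable Q L (GraphVar V ρ ⊕ V') fun M S Y =>
      ∃ g : (V ⊕ ArgVar ρ → M) → P → M,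
        (∀ i, ∀ y ∈ Y, ∀ z, (∀ j, y (.inl (.inr (.inl ⟨i, j⟩))) = z ⟨i, j⟩) →
          y (.inl (.inr (.inr i))) = g (Sum.elim (y ∘ Sum.inl ∘ Sum.inl) z) i) ∧
        T M S (Set.image2 (fun y z => Sum.elim (Sum.elim (y ∘ Sum.inl ∘ Sum.inl) (y ∘ Sum.inr))
          (Sum.elim z (g (Sum.elim (y ∘ Sum.inl ∘ Sum.inl) z)))) Y Set.univ) := by
  let key : V ⊕ ArgVar ρ → (GraphVar V ρ ⊕ V') ⊕ ArgVar ρ := Sum.map (Sum.inl ∘ Sum.inl) id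
  let σ : GraphVar (V ⊕ V') ρ → ((GraphVar V ρ ⊕ V') ⊕ ArgVar ρ) ⊕ P := Sum.elim
    (Sum.elim (Sum.inl ∘ Sum.inl ∘ Sum.inl ∘ Sum.inl) (Sum.inl ∘ Sum.inl ∘ Sum.inr))
    (Sum.elim (Sum.inl ∘ Sum.inr) Sum.inr)
  have hcopy (i : P) := DDefinable.flat_imp_varEq (Q := Q) (L := L)
    (V := ((GraphVar V ρ ⊕ V') ⊕ ArgVar ρ) ⊕ P)
    (.inl (.inl (.inl (.inr (.inr i))))) (.inr i)
    (fun j => .inl (.inl (.inl (.inr (.inl ⟨i, j⟩))))) (fun j => .inl (.inr ⟨i, j⟩))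
  refine ((DDefinable.forall_and hcopy (hT.comap σ)).exists_fun key).alls.congr
    fun M _ S Y => exists_congr fun g => ?_
  have elim_comp_key (y : GraphVar V ρ ⊕ V' → M) z :
      Sum.elim y z ∘ key = Sum.elim (y ∘ Sum.inl ∘ Sum.inl) z := Sum.elim_comp_map ..
  have elim_comp_σ (y : GraphVar V ρ ⊕ V' → M) (z : ArgVar ρ → M) (b : P → M) :
      Sum.elim (Sum.elim y z) b ∘ σ =
        Sum.elim (Sum.elim (y ∘ Sum.inl ∘ Sum.inl) (y ∘ Sum.inr)) (Sum.elim z b) := by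
    funext v
    rcases v with (v | v) | v | v <;> rfl
  simp only [Set.image_image2, Set.forall_mem_image2, Set.mem_univ, forall_const, elim_comp_key,
    elim_comp_σ, funext_iff, Function.comp_apply, Sum.elim_inl, Sum.elim_inr]

theorem FlatlyDefinable.quantify [Finite V] [Finite P] {r : ℕ} {U : GenQuantifier.{u} r}
    (hU : DExpressible Q L U) {A : FunProperty.{u} L ρ (V ⊕ Fin r)}
    (hA : FlatlyDefinable Q L ρ (V ⊕ Fin r) A) :
    FlatlyDefinable Q L ρ V fun M S f x => {a | A M S f (Sum.elim x a)} ∈ U M := by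
  obtain ⟨T, hT, hTA⟩ := hA
  refine ⟨_, hT.refresh.quantify hU id, fun M _ S X f => ⟨?_, fun h => ?_⟩⟩
  · rintro ⟨X', hX', g, hg, hTg⟩ x hx
    by_cases hU₀ : ∅ ∈ U M
    · exact hU.mono _ _ _ (Set.empty_subset _) hU₀
    have g_eq (z : ArgVar ρ → M) (i : P) : g (Sum.elim x z) i = f x i fun j => z ⟨i, j⟩ := by
      obtain ⟨a, ha⟩ := Set.nonempty_iff_ne_empty.2 fun h => hU₀ (h ▸ hX' _ ⟨x, hx, z, rfl⟩)
      exact (hg i _ ha z fun _ => rfl).symm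
    obtain ⟨z₀⟩ : Nonempty (ArgVar ρ → M) := inferInstance
    refine hU.mono _ _ _ (fun a ha => ?_) (hX' _ ⟨x, hx, z₀, rfl⟩)
    refine (hTA M S {Sum.elim x a} fun _ => f x).1 (hT.mono ?_ hTg) _ rfl
    rintro _ ⟨_, rfl, z, rfl⟩
    exact ⟨_, ha, z, trivial,
      congrArg (fun b => Sum.elim (Sum.elim x a) (Sum.elim z b)) (funext (g_eq z))⟩
  · refine ⟨{y | ∃ x ∈ X, ∃ z a, A M S (f x) (Sum.elim x a) ∧
        Sum.elim (graphRow x (f x) z) a = y},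
      forall_mem_graphTeam.2 fun x hx z => ?_,
      fun w i => f (w ∘ Sum.inl) i fun j => w (Sum.inr ⟨i, j⟩), ?_, hT.mono ?_ ((hTA M S
        {w | w ∘ Sum.inl ∈ X ∧ A M S (f (w ∘ Sum.inl)) w} fun w => f (w ∘ Sum.inl)).2
          fun w hw => hw.2)⟩
    · exact hU.mono _ _ _ (fun a ha => ⟨x, hx, z, a, ha, rfl⟩) (h x hx)
    · rintro i _ ⟨x, -, z, a, -, rfl⟩ z' hz
      exact congrArg (f x i) (funext hz)
    · rintro _ ⟨_, ⟨x, hx, z, a, ha, rfl⟩, z', -, rfl⟩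
      exact ⟨Sum.elim x a, ⟨hx, ha⟩, z', rfl⟩

theorem FlatlyDefinable.exists_elim [Finite V] [Finite P] {r : ℕ}
    {A : FunProperty.{u} L ρ (V ⊕ Fin r)} (hA : FlatlyDefinable Q L ρ (V ⊕ Fin r) A) :
    FlatlyDefinable Q L ρ V fun M S f x => ∃ a, A M S f (Sum.elim x a) :=
  hA.quantify (dExpressible_existsQuantifier r)

theorem FlatlyDefinable.subst [Finite V] [Finite P] {r : ℕ} {B : FunProperty.{u} L ρ (V ⊕ Fin r)}
    {G : Fin r → ∀ M : Type u, L.Structure M → FunEnv ρ M → (V → M) → M}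
    (hB : FlatlyDefinable Q L ρ (V ⊕ Fin r) B)
    (hG : ∀ j, FlatlyDefinable Q L ρ (V ⊕ Fin r) fun M S f x =>
      G j M S f (x ∘ Sum.inl) = x (Sum.inr j)) :
    FlatlyDefinable Q L ρ V fun M S f x => B M S f (Sum.elim x fun j => G j M S f x) :=
  (forall_and hG hB).exists_elim.congr fun M _ S f x => by
    simp only [Sum.elim_comp_inl, Sum.elim_inr, ← funext_iff]
    exact exists_eq_left'

theorem FlatlyDefinable.quantify_append [Finite P] {n r : ℕ} {U : GenQuantifier.{u} r}
    (hU : DExpressible Q L U) {A : FunProperty.{u} L ρ (Fin (n + r))}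
    (hA : FlatlyDefinable Q L ρ (Fin (n + r)) A) :
    FlatlyDefinable Q L ρ (Fin n) fun M S f x => {a | A M S f (Fin.append x a)} ∈ U M :=
  ((hA.reindex finSumFinEquiv.symm).quantify hU).congr fun _ _ _ _ _ => by
    simp only [elim_comp_finSumFinEquiv_symm]

end FlatlyDefinable

/-! ### Existential second-order logic in dependence logic -/

/-- Every `L`-structure together with functions of the arities `ρ i` determines an
`L'`-structure. -/
abbrev Interpretation {P : Type} (L L' : FirstOrder.Language.{v, w}) (ρ : P → ℕ) :
    Type (max (u + 1) v w) :=
  ∀ M : Type u, L.Structure M → FunEnv ρ M → L'.Structure M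

/-- The atomic formulas of `L'` without nested terms and their negations are flatly definable in
the structures given by the interpretation `I`. -/
structure Interpretation.IsFlat {k : ℕ} {ι : Type} (Q : ι → GenQuantifier.{u} k)
    {L L' : FirstOrder.Language.{v, w}} {P : Type} {ρ : P → ℕ}
    (I : Interpretation.{u} L L' ρ) : Prop where
  funMap : ∀ {V : Type} [Finite V] {n : ℕ} (g : L'.Functions n) (σ : Fin n → V) (v : V),
    FlatlyDefinable Q L ρ V fun M S f x => (I M S f).funMap g (x ∘ σ) = x v
  relMap : ∀ {V : Type} [Finite V] {n : ℕ} (R : L'.Relations n) (σ : Fin n → V),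
    FlatlyDefinable Q L ρ V fun M S f x => (I M S f).RelMap R (x ∘ σ)
  not_relMap : ∀ {V : Type} [Finite V] {n : ℕ} (R : L'.Relations n) (σ : Fin n → V),
    FlatlyDefinable Q L ρ V fun M S f x => ¬ (I M S f).RelMap R (x ∘ σ)

section IsFlat

variable {k : ℕ} {ι : Type} {Q : ι → GenQuantifier.{u} k} {L L' : FirstOrder.Language.{v, w}}
  {P P' V : Type} {ρ : P → ℕ} {I : Interpretation.{u} L L' ρ}

theorem Interpretation.isFlat_self : IsFlat Q fun _ S (_ : FunEnv ρ _) => (S : L.Structure _) where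
  funMap {V} _ n g σ v :=
    (FlatlyDefinable.atom (n := n + 1)
      (.eq (.func g fun i => .var i.castSucc) (.var (Fin.last n)))
      (Fin.snoc (α := fun _ => V) σ v)).congr fun _ _ _ _ _ => by
        simp [Atom.Holds, Function.comp_def]
  relMap R σ := (FlatlyDefinable.atom (.relOf R id) σ).congr fun _ _ _ _ _ => Atom.holds_relOf ..
  not_relMap R σ :=
    (FlatlyDefinable.natom (.relOf R id) σ).congr fun _ _ _ _ _ => (Atom.holds_relOf ..).not

theorem Interpretation.IsFlat.weaken {e : P' → P} (he : e.Injective)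
    {I : Interpretation.{u} L L' (ρ ∘ e)} (hI : IsFlat Q I) :
    IsFlat (ρ := ρ) Q fun M S f => I M S fun i => f (e i) where
  funMap g σ v := (hI.funMap g σ v).weaken he
  relMap R σ := (hI.relMap R σ).weaken he
  not_relMap R σ := (hI.not_relMap R σ).weaken he

theorem Interpretation.IsFlat.expandFun (hI : IsFlat Q I) (i : P) :
    IsFlat Q fun M S f => TeamLogic.expandFun (I M S f) (f i) where
  funMap
    | .inl g, σ, v => hI.funMap g σ v
    | .inr .sym, σ, v => .apply_eq i σ v
  relMap
    | .inl R, σ => hI.relMap R σ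
  not_relMap
    | .inl R, σ => hI.not_relMap R σ

theorem Interpretation.IsFlat.expandRel (hI : IsFlat Q I) {m : ℕ}
    {B : FunProperty.{u} L ρ (Fin m)}
    (hB : ∀ {V : Type} [Finite V] (σ : Fin m → V),
      FlatlyDefinable Q L ρ V fun M S f x => B M S f (x ∘ σ))
    (hB' : ∀ {V : Type} [Finite V] (σ : Fin m → V),
      FlatlyDefinable Q L ρ V fun M S f x => ¬ B M S f (x ∘ σ)) :
    IsFlat Q fun M S f => TeamLogic.expandRel (I M S f) (B M S f) where
  funMap
    | .inl g, σ, v => hI.funMap g σ v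
  relMap
    | .inl R, σ => hI.relMap R σ
    | .inr .sym, σ => hB σ
  not_relMap
    | .inl R, σ => hI.not_relMap R σ
    | .inr .sym, σ => hB' σ

theorem Interpretation.IsFlat.expandRel_eq [Finite P] {m : ℕ} (hI : IsFlat Q I) :
    IsFlat (ρ := (Option.elim · m (Option.elim · m ρ))) Q fun M S f =>
      TeamLogic.expandRel (I M S fun i => f (some (some i)))
        fun x => f none x = f (some none) x := by
  let ρ' : Option (Option P) → ℕ := (Option.elim · m (Option.elim · m ρ))
  let value {V : Type} (σ : Fin m → V) (j : Fin 2) (M : Type u) (_ : L.Structure M)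
    (f : FunEnv ρ' M) (x : V → M) : M := ![f none (x ∘ σ), f (some none) (x ∘ σ)] j
  have value_eq {V : Type} (σ : Fin m → V) : ∀ j, FlatlyDefinable Q L ρ' (V ⊕ Fin 2)
      fun M S f x => value σ j M S f (x ∘ Sum.inl) = x (Sum.inr j) := by
    rw [Fin.forall_fin_two]
    exact ⟨.apply_eq (ρ := ρ') none (Sum.inl ∘ σ) (Sum.inr 0),
      .apply_eq (ρ := ρ') (some none) (Sum.inl ∘ σ) (Sum.inr 1)⟩
  refine (hI.weaken ((Option.some_injective _).comp (Option.some_injective _))).expandRel ?_ ?_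
  · exact fun σ => FlatlyDefinable.subst (G := value σ)
      (.atom (n := 2) (.eq (.var 0) (.var 1)) (Sum.inr ∘ ![0, 1])) (value_eq σ)
  · exact fun σ => FlatlyDefinable.subst (G := value σ)
      (.natom (n := 2) (.eq (.var 0) (.var 1)) (Sum.inr ∘ ![0, 1])) (value_eq σ)

theorem Interpretation.IsFlat.expandRel_empty [Finite P] (hI : IsFlat Q I) (m : ℕ) :
    IsFlat Q fun M S f => TeamLogic.expandRel (m := m) (I M S f) fun _ => False := by
  let a : Atom L 1 := .eq (.var 0) (.var 0)
  refine hI.expandRel (fun {V} _ _ => ?_) (fun {V} _ _ => ?_)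
  · exact (FlatlyDefinable.natom (V := V ⊕ Fin 1) a Sum.inr).exists_elim.congr fun _ _ _ _ _ =>
      by simp [a, Atom.Holds]
  · exact (FlatlyDefinable.atom (V := V ⊕ Fin 1) a Sum.inr).exists_elim.congr fun _ _ _ _ _ =>
      by simp [a, Atom.Holds]

theorem Interpretation.IsFlat.realize_eq [Finite P] (hI : IsFlat Q I) {q : ℕ}
    (t : L'.Term (Fin q)) :
    ∀ {V : Type} [Finite V] (σ : Fin q → V) (v : V), FlatlyDefinable Q L ρ V fun M S f x =>
      letI := I M S f
      t.realize (x ∘ σ) = x v := by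
  induction t with
  | var i => exact fun σ v => .atom (n := 2) (.eq (.var 0) (.var 1)) ![σ i, v]
  | func g ts ih =>
    intro V _ σ v
    exact (hI.funMap g Sum.inr (Sum.inl v)).subst fun j => ih j (Sum.inl ∘ σ) (Sum.inr j)

theorem Interpretation.IsFlat.atom [Finite P] (hI : IsFlat Q I) {n : ℕ} (a : Atom L' n) :
    FlatlyDefinable Q L ρ (Fin n) fun M S f x => a.Holds (I M S f) x := by
  cases a with
  | eq t₁ t₂ =>
    exact FlatlyDefinable.subst (G := fun j M S f x => letI := I M S f; (![t₁, t₂] j).realize x)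
      (.atom (n := 2) (.eq (.var 0) (.var 1)) (Sum.inr ∘ ![0, 1]))
      fun j => hI.realize_eq (![t₁, t₂] j) Sum.inl (Sum.inr j)
  | rel R ts =>
    exact (hI.relMap R Sum.inr).subst fun j => hI.realize_eq (ts j) Sum.inl (Sum.inr j)

theorem Interpretation.IsFlat.natom [Finite P] (hI : IsFlat Q I) {n : ℕ} (a : Atom L' n) :
    FlatlyDefinable Q L ρ (Fin n) fun M S f x => ¬ a.Holds (I M S f) x := by
  cases a with
  | eq t₁ t₂ =>
    exact FlatlyDefinable.subst (G := fun j M S f x => letI := I M S f; (![t₁, t₂] j).realize x)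
      (.natom (n := 2) (.eq (.var 0) (.var 1)) (Sum.inr ∘ ![0, 1]))
      fun j => hI.realize_eq (![t₁, t₂] j) Sum.inl (Sum.inr j)
  | rel R ts =>
    exact (hI.not_relMap R Sum.inr).subst fun j => hI.realize_eq (ts j) Sum.inl (Sum.inr j)

end IsFlat

section ESO

variable {k : ℕ} {ι : Type} {Q : ι → GenQuantifier.{u} k} {L L' : FirstOrder.Language.{v, w}}

theorem ESOFormula.flatlyDefinable (hQ : ∀ i, (Q i).Mono) {n : ℕ} (φ : ESOFormula k ι L' n) :
    ∀ {P : Type} [Finite P] {ρ : P → ℕ} {I : Interpretation.{u} L L' ρ}, I.IsFlat Q →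
      FlatlyDefinable Q L ρ (Fin n) fun M S f x => φ.Sat Q (I M S f) x := by
  induction φ with
  | atom a => exact fun hI => hI.atom a
  | natom a => exact fun hI => hI.natom a
  | and φ ψ ihφ ihψ => exact fun hI => (ihφ hI).and (ihψ hI)
  | or φ ψ ihφ ihψ => exact fun hI => (ihφ hI).or (ihψ hI)
  | ex φ ih =>
    exact fun hI => ((ih hI).quantify_append (dExpressible_existsQuantifier 1)).congr
      fun _ _ _ _ _ => append_mem_existsQuantifier_one
  | all φ ih =>
    exact fun hI => ((ih hI).quantify_append (dExpressible_forallQuantifier 1)).congr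
      fun _ _ _ _ _ => append_mem_forallQuantifier_one
  | quant i φ ih => exact fun hI => (ih hI).quantify_append (dExpressible_apply (hQ i))
  | exFun m φ ih =>
    intro P _ ρ I hI
    exact (ih (ρ := (Option.elim · m ρ))
      ((hI.weaken (Option.some_injective P)).expandFun none)).exFun
  | exRel m φ ih =>
    intro P _ ρ I hI
    exact (((ih hI.expandRel_eq).exFun.exFun).or (ih (hI.expandRel_empty m))).congr
      fun M _ S f x => (exists_pred_iff_exists_eq
        (p := fun R => φ.Sat Q (TeamLogic.expandRel (I M S f) R) x)).symm

theorem ESOFormula.exists_dFormula (hQ : ∀ i, (Q i).Mono) (φ : ESOFormula k ι L 0) :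
    ∃ ψ : DFormula k ι L 0, ∀ (M : Type u) [Nonempty M] [L.Structure M],
      φ.TrueIn Q M ↔ ψ.TrueIn Q M := by
  obtain ⟨T, hT, hTφ⟩ := φ.flatlyDefinable hQ (ρ := Empty.elim) Interpretation.isFlat_self
  let e : GraphVar (Fin 0) Empty.elim → Fin 0 := isEmptyElim
  obtain ⟨ψ, hψ⟩ := hT.formula e
  refine ⟨ψ, fun M _ S => ?_⟩
  let f : (Fin 0 → M) → FunEnv Empty.elim M := fun _ => Empty.rec
  have hnonempty : (graphTeam {Fin.elim0} f).Nonempty := ⟨_, _, rfl, fun p => p.1.elim, rfl⟩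
  have image_eq_graphTeam : (· ∘ e) '' {Fin.elim0} = graphTeam {Fin.elim0} f := by
    rw [Subsingleton.eq_univ_of_nonempty hnonempty]
    exact Subsingleton.eq_univ_of_nonempty ((Set.singleton_nonempty _).image _)
  rw [ESOFormula.TrueIn, DFormula.TrueIn, hψ, image_eq_graphTeam, hTφ]
  exact forall_eq.symm

end ESO

end TeamLogic

theorem mainTheorem5_general {k : ℕ} {ι κ : Type} {Q : ι → TeamLogic.GenQuantifier.{u} k}
    {R : κ → TeamLogic.GenQuantifier.{u} k} (hR : ∀ j, (R j).Mono) {pos neg : ι → κ}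
    (hpos : ∀ i, R (pos i) = Q i) (hneg : ∀ i, R (neg i) = (Q i).dual)
    (L : FirstOrder.Language.{v, w}) :
    (∀ φ : TeamLogic.ESOFormula k κ L 0, ∃ ψ : TeamLogic.DFormula k κ L 0,
      ∀ (M : Type u) [Nonempty M] [L.Structure M], φ.TrueIn R M ↔ ψ.TrueIn R M) ∧
    (∀ ψ : TeamLogic.DFormula k κ L 0, ∃ φ : TeamLogic.ESOFormula k κ L 0,
      ∀ (M : Type u) [L.Structure M], ψ.TrueIn R M ↔ φ.TrueIn R M) ∧
    (∀ χ : TeamLogic.FOFormula k ι L 0, ∃ ψ : TeamLogic.DFormula k κ L 0,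
      ∀ (M : Type u) [Nonempty M] [L.Structure M], χ.TrueIn Q M ↔ ψ.TrueIn R M) := by
  refine ⟨fun φ => φ.exists_dFormula hR, fun ψ => ψ.exists_esoFormula R, fun χ => ?_⟩
  obtain ⟨φ, hφ⟩ := (χ.esoDefinable hpos hneg).1
  obtain ⟨ψ, hψ⟩ := φ.exists_dFormula hR
  exact ⟨ψ, fun M _ S => (hφ M S _).symm.trans (hψ M)⟩

theorem mainTheorem5 {k : ℕ} (Q : TeamLogic.GenQuantifier.{u} k) (hQ : Q.Mono)
    (L : FirstOrder.Language.{v, w}) :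
    (∀ φ : TeamLogic.ESOFormula k (Fin 2) L 0, ∃ ψ : TeamLogic.DFormula k (Fin 2) L 0,
      ∀ (M : Type u) [Nonempty M] [L.Structure M],
        φ.TrueIn ![Q, Q.dual] M ↔ ψ.TrueIn ![Q, Q.dual] M) ∧
    (∀ ψ : TeamLogic.DFormula k (Fin 2) L 0, ∃ φ : TeamLogic.ESOFormula k (Fin 2) L 0,
      ∀ (M : Type u) [Nonempty M] [L.Structure M],
        ψ.TrueIn ![Q, Q.dual] M ↔ φ.TrueIn ![Q, Q.dual] M) ∧
    (∀ χ : TeamLogic.FOFormula k (Fin 1) L 0, ∃ ψ : TeamLogic.DFormula k (Fin 2) L 0,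
      ∀ (M : Type u) [Nonempty M] [L.Structure M],
        χ.TrueIn ![Q] M ↔ ψ.TrueIn ![Q, Q.dual] M) := by
  have h := mainTheorem5_general (Q := ![Q]) (R := ![Q, Q.dual]) (pos := fun _ => 0)
    (neg := fun _ => 1) (Fin.forall_fin_two.2 ⟨hQ, hQ.dual⟩) (Fin.forall_fin_one.2 rfl)
    (Fin.forall_fin_one.2 rfl) L
  exact ⟨h.1, fun ψ => (h.2.1 ψ).imp fun _ hφ M _ => hφ M, h.2.2⟩
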